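/- Conventions. A directed graph $E=(E^0,E^1,r,s)$ is row-finite if $r^{-1}(v)$ is finite for every vertex $v\in E^0$. A Cuntz--Krieger $E$-family in a $C^*$-algebra consists of mutually orthogonal projections $p_v$ ($v\in E^0$) and partial isometries $s_e$ ($e\in E^1$) with $s_e^*s_e=p_{s(e)}$, $p_{r(e)}s_e=s_e$, and $p_v=\sum_{r(e)=v}s_es_e^*$ for every $v$ with $r^{-1}(v)\neq\emptyset$; $C^*(E)$ is the $C^*$-algebra generated by a universal such family $\{p_v,s_e\}$. The gauge action of $\mathbb T$ is given by the $*$-automorphisms $\gamma_z$ with $\gamma_z(p_v)=p_v$ and $\gamma_z(s_e)=zs_e$; an ideal $J$ is gauge-invariant if $\gamma_z(J)\subseteq J$ for all $z\in\mathbb T$. A cycle is a finite sequence of edges $\alpha_1,\dots,\alpha_n$, $n\ge 1$, with $s(\alpha_i)=r(\alpha_{i+1})$ for $i<n$ and $r(\alpha_1)=s(\alpha_n)$. The graph $E$ satisfies Condition (L) if every cycle has an entry, i.e. for every cycle $\alpha_1,\dots,\alpha_n$ there are an $i$ and an edge $e\neq\alpha_i$ with $r(e)=r(\alpha_i)$.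 For a subset $X$ of a $C^*$-algebra $A$ let $X^\perp=\{a\in A: ax=xa=0 \text{ for all } x\in X\}$; an ideal $J$ of $A$ is regular if $J=J^{\perp\perp}$. Ideals are closed and two-sided. Theorem. Let $E$ be a row-finite directed graph satisfying Condition (L), and let $J$ be a regular, gauge-invariant ideal of $C^*(E)$. Put $H(J)=\{v\in E^0: p_v\in J\}$ and let $$E/J=(E^0\setminus H(J),\ E^1\setminus s^{-1}(H(J)),\ r,\ s)$$ be the quotient graph. Then $E/J$ satisfies Condition (L), and $C^*(E)/J$ is $*$-isomorphic to $C^*(E/J)$. -/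

import Mathlib

universe u v w

/-- A row-finite directed graph with vertex type `V` and edge type `Ed`: range and source maps,
such that every vertex receives only finitely many edges. -/
structure RowFiniteGraph (V : Type u) (Ed : Type v) where
  /-- the range map -/
  r : Ed → V
  /-- the source map -/
  s : Ed → V
  /-- row-finiteness -/
  finite_fiber : ∀ x : V, {e : Ed | r e = x}.Finite

namespace RowFiniteGraph

/-- `α₀ α₁ … αₙ` is a cycle (a path of length `n + 1 ≥ 1` with equal range and source):
`s(αᵢ) = r(αᵢ₊₁)` for `i < n`, and `r(α₀) = s(αₙ)`. -/
def IsCycle {V : Type u} {Ed : Type v} (E : RowFiniteGraph V Ed) (n : ℕ)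
    (α : Fin (n + 1) → Ed) : Prop :=
  (∀ i : Fin n, E.s (α i.castSucc) = E.r (α i.succ)) ∧ E.r (α 0) = E.s (α (Fin.last n))

/-- Condition (L): every cycle has an entry. -/
def ConditionL {V : Type u} {Ed : Type v} (E : RowFiniteGraph V Ed) : Prop :=
  ∀ (n : ℕ) (α : Fin (n + 1) → Ed), E.IsCycle n α →
    ∃ (i : Fin (n + 1)) (e : Ed), e ≠ α i ∧ E.r e = E.r (α i)

/-- A Cuntz–Krieger `E`-family: mutually orthogonal projections `P x` and elements `S e` with
`S e* S e = P (s e)`, `P (r e) S e = S e`, and `P x = ∑_{r e = x} S e S e*` for every vertex `x`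
that receives an edge. -/
structure IsCKFamily {V : Type u} {Ed : Type v} (E : RowFiniteGraph V Ed) {A : Type w}
    [NonUnitalRing A] [StarRing A] (P : V → A) (S : Ed → A) : Prop where
  star_p : ∀ x, star (P x) = P x
  p_mul_self : ∀ x, P x * P x = P x
  p_mul_p : ∀ x y, x ≠ y → P x * P y = 0
  star_s_mul_s : ∀ e, star (S e) * S e = P (E.s e)
  p_mul_s : ∀ e, P (E.r e) * S e = S e
  sum_s : ∀ x, (∃ e, E.r e = x) → ∑ e ∈ (E.finite_fiber x).toFinset, S e * star (S e) = P x

/-! ### The free unital `*`-algebra on the generators -/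

/-- Generators: symbols for `p x`, `s e` and `(s e)*`. -/
inductive Gen (V : Type u) (Ed : Type v) : Type (max u v)
  | p (x : V) : Gen V Ed
  | s (e : Ed) : Gen V Ed
  | sAdj (e : Ed) : Gen V Ed
  | pAdj (x : V) : Gen V Ed

/-- The involution on symbols. -/
def Gen.adj {V : Type u} {Ed : Type v} : Gen V Ed → Gen V Ed
  | .p x => .pAdj x
  | .pAdj x => .p x
  | .s e => .sAdj e
  | .sAdj e => .s e

theorem Gen.adj_adj {V : Type u} {Ed : Type v} (g : Gen V Ed) : g.adj.adj = g := by
  cases g <;> rfl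

/-- The adjoint of a word: reverse it and take the adjoint of every letter. -/
def wordAdj {V : Type u} {Ed : Type v} (m : FreeMonoid (Gen V Ed)) : FreeMonoid (Gen V Ed) :=
  FreeMonoid.ofList ((m.toList.map Gen.adj).reverse)

theorem wordAdj_wordAdj {V : Type u} {Ed : Type v} (m : FreeMonoid (Gen V Ed)) :
    wordAdj (wordAdj m) = m := by
  have h : (Gen.adj ∘ Gen.adj : Gen V Ed → Gen V Ed) = id := funext Gen.adj_adj
  simp [wordAdj, List.map_reverse, h]

theorem wordAdj_mul {V : Type u} {Ed : Type v} (m m' : FreeMonoid (Gen V Ed)) :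
    wordAdj (m * m') = wordAdj m' * wordAdj m := by
  simp [wordAdj]

/-- The free complex unital `*`-algebra on the symbols `p x`, `s e`: finite linear combinations of
words in the symbols and their adjoints. The graph enters only through the norm defined below. -/
def PreAlg {V : Type u} {Ed : Type v} (_E : RowFiniteGraph V Ed) : Type (max u v) :=
  MonoidAlgebra ℂ (FreeMonoid (Gen V Ed))

namespace PreAlg

noncomputable instance {V : Type u} {Ed : Type v} (E : RowFiniteGraph V Ed) : Ring E.PreAlg :=
  inferInstanceAs (Ring (MonoidAlgebra ℂ (FreeMonoid (Gen V Ed))))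

noncomputable instance {V : Type u} {Ed : Type v} (E : RowFiniteGraph V Ed) :
    Algebra ℂ E.PreAlg :=
  inferInstanceAs (Algebra ℂ (MonoidAlgebra ℂ (FreeMonoid (Gen V Ed))))

/-- The scalar multiple `c m` of a word `m`. -/
noncomputable def mono {V : Type u} {Ed : Type v} (E : RowFiniteGraph V Ed)
    (m : FreeMonoid (Gen V Ed)) (c : ℂ) : E.PreAlg :=
  MonoidAlgebra.single m c

theorem mono_mul {V : Type u} {Ed : Type v} (E : RowFiniteGraph V Ed)
    (m m' : FreeMonoid (Gen V Ed)) (c c' : ℂ) :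
    mono E m c * mono E m' c' = mono E (m * m') (c * c') :=
  MonoidAlgebra.single_mul_single m m' c c'

theorem smul_mono {V : Type u} {Ed : Type v} (E : RowFiniteGraph V Ed)
    (m : FreeMonoid (Gen V Ed)) (c c' : ℂ) : c • mono E m c' = mono E m (c * c') :=
  MonoidAlgebra.smul_single' c m c'

theorem mono_add {V : Type u} {Ed : Type v} (E : RowFiniteGraph V Ed)
    (m : FreeMonoid (Gen V Ed)) (c c' : ℂ) : mono E m (c + c') = mono E m c + mono E m c' :=
  MonoidAlgebra.single_add m c c'

theorem mono_zero {V : Type u} {Ed : Type v} (E : RowFiniteGraph V Ed)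
    (m : FreeMonoid (Gen V Ed)) : mono E m 0 = 0 :=
  MonoidAlgebra.single_zero m

theorem induction_linear {V : Type u} {Ed : Type v} {E : RowFiniteGraph V Ed}
    {motive : E.PreAlg → Prop} (x : E.PreAlg) (zero : motive 0)
    (add : ∀ x y, motive x → motive y → motive (x + y))
    (mono : ∀ m c, motive (mono E m c)) : motive x :=
  MonoidAlgebra.induction_linear (motive := motive) x zero add mono

/-- The conjugate-linear map that takes every word to its adjoint. -/
noncomputable instance {V : Type u} {Ed : Type v} (E : RowFiniteGraph V Ed) : Star E.PreAlg where
  star x := (MonoidAlgebra.coeff x).sum fun m c => mono E (wordAdj m) (star c)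

theorem star_mono {V : Type u} {Ed : Type v} (E : RowFiniteGraph V Ed)
    (m : FreeMonoid (Gen V Ed)) (c : ℂ) : star (mono E m c) = mono E (wordAdj m) (star c) := by
  change (Finsupp.single m c).sum (fun m c => mono E (wordAdj m) (star c)) = _
  rw [Finsupp.sum_single_index]
  simp [mono_zero]

theorem star_add' {V : Type u} {Ed : Type v} (E : RowFiniteGraph V Ed)
    (x y : E.PreAlg) : star (x + y) = star x + star y := by
  change (MonoidAlgebra.coeff x + MonoidAlgebra.coeff y).sum
    (fun m c => mono E (wordAdj m) (star c)) = _
  rw [Finsupp.sum_add_index']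
  · rfl
  · simp [mono_zero]
  · simp [mono_add]

theorem star_zero' {V : Type u} {Ed : Type v} (E : RowFiniteGraph V Ed) :
    star (0 : E.PreAlg) = 0 := by
  change (0 : FreeMonoid (Gen V Ed) →₀ ℂ).sum (fun m c => mono E (wordAdj m) (star c)) = _
  simp

noncomputable instance {V : Type u} {Ed : Type v} (E : RowFiniteGraph V Ed) :
    StarRing E.PreAlg where
  star_involutive x := by
    induction x using induction_linear with
    | zero => simp [star_zero']
    | add x y hx hy => rw [star_add', star_add', hx, hy]
    | mono m c => simp [star_mono, wordAdj_wordAdj]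
  star_add := star_add' E
  star_mul x y := by
    induction x using induction_linear with
    | zero => simp [star_zero']
    | add x x' hx hx' => rw [add_mul, star_add', hx, hx', star_add', mul_add]
    | mono m c =>
      induction y using induction_linear with
      | zero => simp [star_zero']
      | add y y' hy hy' => rw [mul_add, star_add', hy, hy', star_add', add_mul]
      | mono m' c' => simp [star_mono, mono_mul, wordAdj_mul, mul_comm]

instance {V : Type u} {Ed : Type v} (E : RowFiniteGraph V Ed) : StarModule ℂ E.PreAlg where
  star_smul c x := by
    induction x using induction_linear with
    | zero => simp
    | add x y hx hy => rw [smul_add, star_add, hx, hy, star_add, smul_add]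
    | mono m c' => simp [star_mono, smul_mono]

/-- The symbol for the vertex projection. -/
noncomputable def gp {V : Type u} {Ed : Type v} (E : RowFiniteGraph V Ed) (x : V) : E.PreAlg :=
  mono E (FreeMonoid.of (.p x)) 1

/-- The symbol for the partial isometry of an edge. -/
noncomputable def gs {V : Type u} {Ed : Type v} (E : RowFiniteGraph V Ed) (e : Ed) : E.PreAlg :=
  mono E (FreeMonoid.of (.s e)) 1

/-- The differences of the two sides of the Cuntz–Krieger relations. -/
inductive Relator {V : Type u} {Ed : Type v} (E : RowFiniteGraph V Ed) : E.PreAlg → Prop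
  | star_p (x : V) : Relator E (star (gp E x) - gp E x)
  | p_mul_self (x : V) : Relator E (gp E x * gp E x - gp E x)
  | p_mul_p (x y : V) (h : x ≠ y) : Relator E (gp E x * gp E y)
  | star_s_mul_s (e : Ed) : Relator E (star (gs E e) * gs E e - gp E (E.s e))
  | p_mul_s (e : Ed) : Relator E (gp E (E.r e) * gs E e - gs E e)
  | sum_s (x : V) (h : ∃ e, E.r e = x) :
      Relator E (∑ e ∈ (E.finite_fiber x).toFinset, gs E e * star (gs E e) - gp E x)

/-- A `C*`-seminorm on the free `*`-algebra in which the Cuntz–Krieger relations hold. -/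
structure IsCKSeminorm {V : Type u} {Ed : Type v} (E : RowFiniteGraph V Ed)
    (q : Seminorm ℂ E.PreAlg) : Prop where
  mul_le : ∀ x y, q (x * y) ≤ q x * q y
  star_mul_self : ∀ x, q (star x * x) = q x * q x
  relator : ∀ x, Relator E x → q x = 0

/-- The largest such seminorm. -/
noncomputable def univNorm {V : Type u} {Ed : Type v} (E : RowFiniteGraph V Ed) (x : E.PreAlg) :
    ℝ :=
  ⨆ q : {q : Seminorm ℂ E.PreAlg // IsCKSeminorm E q}, q.1 x

theorem IsCKSeminorm.star_le {V : Type u} {Ed : Type v} {E : RowFiniteGraph V Ed}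
    {q : Seminorm ℂ E.PreAlg} (hq : IsCKSeminorm E q) (x : E.PreAlg) : q x ≤ q (star x) := by
  rcases (apply_nonneg q x).eq_or_lt with h | h
  · rw [← h]; exact apply_nonneg q _
  · have h1 := hq.star_mul_self x
    have h2 := hq.mul_le (star x) x
    rw [h1] at h2
    exact le_of_mul_le_mul_right h2 h

theorem IsCKSeminorm.star_eq {V : Type u} {Ed : Type v} {E : RowFiniteGraph V Ed}
    {q : Seminorm ℂ E.PreAlg} (hq : IsCKSeminorm E q) (x : E.PreAlg) : q (star x) = q x :=
  le_antisymm (by simpa using hq.star_le (star x)) (hq.star_le x)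

theorem IsCKSeminorm.eq_of_sub {V : Type u} {Ed : Type v} {E : RowFiniteGraph V Ed}
    {q : Seminorm ℂ E.PreAlg} {x y : E.PreAlg} (h : q (x - y) = 0) : q x = q y := by
  have h1 : q x ≤ q (x - y) + q y := by simpa using map_add_le_add q (x - y) y
  have h2 : q y ≤ q (y - x) + q x := by simpa using map_add_le_add q (y - x) x
  rw [map_sub_rev] at h2
  rw [h] at h1 h2
  linarith

theorem le_one_of_mul_self {t t' : ℝ} (ht' : t' ≤ 1) (h : t * t = t') :
    t ≤ 1 := by nlinarith

theorem IsCKSeminorm.one_le {V : Type u} {Ed : Type v} {E : RowFiniteGraph V Ed}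
    {q : Seminorm ℂ E.PreAlg} (hq : IsCKSeminorm E q) : q 1 ≤ 1 := by
  have h := hq.star_mul_self 1
  simp only [star_one, mul_one] at h
  nlinarith [apply_nonneg q 1]

theorem IsCKSeminorm.gp_le {V : Type u} {Ed : Type v} {E : RowFiniteGraph V Ed}
    {q : Seminorm ℂ E.PreAlg} (hq : IsCKSeminorm E q) (x : V) : q (gp E x) ≤ 1 := by
  have h : q (star (gp E x) * gp E x - gp E x) = 0 := by
    have e : star (gp E x) * gp E x - gp E x =
        (star (gp E x) - gp E x) * gp E x + (gp E x * gp E x - gp E x) := by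
      rw [sub_mul]; abel
    refine le_antisymm ?_ (apply_nonneg q _)
    rw [e]
    refine (map_add_le_add q _ _).trans ?_
    rw [hq.relator _ (Relator.p_mul_self x), add_zero]
    refine (hq.mul_le _ _).trans ?_
    rw [hq.relator _ (Relator.star_p x), zero_mul]
  have h1 := IsCKSeminorm.eq_of_sub h
  rw [hq.star_mul_self] at h1
  nlinarith [apply_nonneg q (gp E x)]

theorem IsCKSeminorm.gs_le {V : Type u} {Ed : Type v} {E : RowFiniteGraph V Ed}
    {q : Seminorm ℂ E.PreAlg} (hq : IsCKSeminorm E q) (e : Ed) : q (gs E e) ≤ 1 := by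
  have h := IsCKSeminorm.eq_of_sub (hq.relator _ (Relator.star_s_mul_s e))
  rw [hq.star_mul_self] at h
  exact le_one_of_mul_self (hq.gp_le _) h

theorem IsCKSeminorm.word_le {V : Type u} {Ed : Type v} {E : RowFiniteGraph V Ed}
    {q : Seminorm ℂ E.PreAlg} (hq : IsCKSeminorm E q) (m : FreeMonoid (Gen V Ed)) :
    q (mono E m 1) ≤ 1 := by
  induction m using FreeMonoid.inductionOn' with
  | one => exact hq.one_le
  | of_mul g m ih =>
    have hg : q (mono E (FreeMonoid.of g) 1) ≤ 1 := by
      cases g with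
      | p x => exact hq.gp_le x
      | s e => exact hq.gs_le e
      | pAdj x =>
        have h := hq.star_eq (gp E x)
        rw [gp, star_mono] at h
        simpa [wordAdj, Gen.adj] using h.le.trans (hq.gp_le x)
      | sAdj e =>
        have h := hq.star_eq (gs E e)
        rw [gs, star_mono] at h
        simpa [wordAdj, Gen.adj] using h.le.trans (hq.gs_le e)
    have h := hq.mul_le (mono E (FreeMonoid.of g) 1) (mono E m 1)
    rw [mono_mul, one_mul] at h
    exact h.trans (mul_le_one₀ hg (apply_nonneg q _) ih)

/-- Every element is bounded uniformly over all Cuntz–Krieger seminorms. -/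
theorem bddAbove {V : Type u} {Ed : Type v} (E : RowFiniteGraph V Ed) (x : E.PreAlg) :
    BddAbove (Set.range fun q : {q : Seminorm ℂ E.PreAlg // IsCKSeminorm E q} => q.1 x) := by
  suffices h : ∃ C : ℝ, ∀ q : Seminorm ℂ E.PreAlg, IsCKSeminorm E q → q x ≤ C by
    obtain ⟨C, hC⟩ := h
    exact ⟨C, by rintro _ ⟨q, rfl⟩; exact hC q.1 q.2⟩
  induction x using induction_linear with
  | zero => exact ⟨0, fun q _ => by simp⟩
  | add x y hx hy =>
    obtain ⟨C, hC⟩ := hx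
    obtain ⟨D, hD⟩ := hy
    exact ⟨C + D, fun q hq => (map_add_le_add q x y).trans (add_le_add (hC q hq) (hD q hq))⟩
  | mono m c =>
    refine ⟨‖c‖, fun q hq => ?_⟩
    have h : mono E m c = c • mono E m 1 := by rw [smul_mono, mul_one]
    rw [h, map_smul_eq_mul]
    exact mul_le_of_le_one_right (norm_nonneg c) (hq.word_le m)

theorem isCKSeminorm_zero {V : Type u} {Ed : Type v} (E : RowFiniteGraph V Ed) :
    IsCKSeminorm E 0 where
  mul_le x y := by simp
  star_mul_self x := by simp
  relator x _ := by simp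

instance {V : Type u} {Ed : Type v} (E : RowFiniteGraph V Ed) :
    Nonempty {q : Seminorm ℂ E.PreAlg // IsCKSeminorm E q} := ⟨⟨0, isCKSeminorm_zero E⟩⟩

theorem le_univNorm {V : Type u} {Ed : Type v} {E : RowFiniteGraph V Ed}
    {q : Seminorm ℂ E.PreAlg} (hq : IsCKSeminorm E q) (x : E.PreAlg) : q x ≤ univNorm E x :=
  le_ciSup (bddAbove E x) (⟨q, hq⟩ : {q : Seminorm ℂ E.PreAlg // IsCKSeminorm E q})

theorem univNorm_nonneg {V : Type u} {Ed : Type v} (E : RowFiniteGraph V Ed) (x : E.PreAlg) :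
    0 ≤ univNorm E x :=
  Real.iSup_nonneg fun q => apply_nonneg q.1 x

/-- The largest Cuntz–Krieger seminorm as a seminorm. -/
noncomputable def univSeminorm {V : Type u} {Ed : Type v} (E : RowFiniteGraph V Ed) :
    Seminorm ℂ E.PreAlg :=
  Seminorm.of (univNorm E)
    (fun x y => ciSup_le fun q => (map_add_le_add q.1 x y).trans
      (add_le_add (le_univNorm q.2 x) (le_univNorm q.2 y)))
    (fun c x => by
      simp only [univNorm, map_smul_eq_mul]
      exact (Real.mul_iSup_of_nonneg (norm_nonneg c) _).symm)

theorem isCKSeminorm_univSeminorm {V : Type u} {Ed : Type v} (E : RowFiniteGraph V Ed) :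
    IsCKSeminorm E (univSeminorm E) where
  mul_le x y := ciSup_le fun q => (q.2.mul_le x y).trans
    (mul_le_mul (le_univNorm q.2 x) (le_univNorm q.2 y) (apply_nonneg _ _) (univNorm_nonneg E x))
  star_mul_self x := by
    change univNorm E (star x * x) = univNorm E x * univNorm E x
    refine le_antisymm (ciSup_le fun q => ?_) ?_
    · rw [q.2.star_mul_self]
      exact mul_self_le_mul_self (apply_nonneg _ _) (le_univNorm q.2 x)
    · have h : univNorm E x ≤ Real.sqrt (univNorm E (star x * x)) := by
        refine ciSup_le fun q => Real.le_sqrt_of_sq_le ?_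
        rw [sq, ← q.2.star_mul_self]
        exact le_univNorm q.2 _
      calc univNorm E x * univNorm E x
          ≤ Real.sqrt (univNorm E (star x * x)) * Real.sqrt (univNorm E (star x * x)) :=
            mul_self_le_mul_self (univNorm_nonneg E x) h
        _ = _ := Real.mul_self_sqrt (univNorm_nonneg E _)
  relator x hx := by
    change univNorm E x = 0
    refine le_antisymm (ciSup_le fun q => ?_) (univNorm_nonneg E x)
    rw [q.2.relator x hx]

/-- The free `*`-algebra carries the largest Cuntz–Krieger seminorm. -/
noncomputable instance {V : Type u} {Ed : Type v} (E : RowFiniteGraph V Ed) :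
    SeminormedRing E.PreAlg :=
  RingSeminorm.toSeminormedRing
    { toFun := univSeminorm E
      map_zero' := map_zero _
      add_le' := map_add_le_add _
      neg' := map_neg_eq_map _
      mul_le' := (isCKSeminorm_univSeminorm E).mul_le }

theorem norm_def {V : Type u} {Ed : Type v} (E : RowFiniteGraph V Ed) (x : E.PreAlg) :
    ‖x‖ = univSeminorm E x := rfl

noncomputable instance {V : Type u} {Ed : Type v} (E : RowFiniteGraph V Ed) :
    NormedAlgebra ℂ E.PreAlg where
  norm_smul_le c x := (map_smul_eq_mul (univSeminorm E) c x).le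

noncomputable instance {V : Type u} {Ed : Type v} (E : RowFiniteGraph V Ed) :
    NormedStarGroup E.PreAlg where
  norm_star_le x := ((isCKSeminorm_univSeminorm E).star_eq x).le

end PreAlg

/-! ### The universal unital `C*`-algebra and the graph `C*`-algebra -/

/-- The universal unital `C*`-algebra of a Cuntz–Krieger `E`-family: the Hausdorff completion of
the free unital `*`-algebra in the largest Cuntz–Krieger seminorm. -/
def UnitalAlg {V : Type u} {Ed : Type v} (E : RowFiniteGraph V Ed) : Type (max u v) :=
  UniformSpace.Completion E.PreAlg

namespace UnitalAlg

noncomputable instance {V : Type u} {Ed : Type v} (E : RowFiniteGraph V Ed) :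
    NormedRing E.UnitalAlg :=
  inferInstanceAs (NormedRing (UniformSpace.Completion E.PreAlg))

instance {V : Type u} {Ed : Type v} (E : RowFiniteGraph V Ed) : CompleteSpace E.UnitalAlg :=
  inferInstanceAs (CompleteSpace (UniformSpace.Completion E.PreAlg))

noncomputable instance {V : Type u} {Ed : Type v} (E : RowFiniteGraph V Ed) :
    Algebra ℂ E.UnitalAlg :=
  inferInstanceAs (Algebra ℂ (UniformSpace.Completion E.PreAlg))

noncomputable instance {V : Type u} {Ed : Type v} (E : RowFiniteGraph V Ed) :
    NormedAlgebra ℂ E.UnitalAlg where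
  norm_smul_le c x := norm_smul_le c (show UniformSpace.Completion E.PreAlg from x)

/-- The canonical map from the free `*`-algebra. -/
noncomputable def of {V : Type u} {Ed : Type v} (E : RowFiniteGraph V Ed) :
    E.PreAlg →+* E.UnitalAlg :=
  UniformSpace.Completion.coeRingHom

theorem of_smul {V : Type u} {Ed : Type v} (E : RowFiniteGraph V Ed) (c : ℂ) (x : E.PreAlg) :
    of E (c • x) = c • of E x :=
  UniformSpace.Completion.coe_smul c x

theorem norm_of {V : Type u} {Ed : Type v} (E : RowFiniteGraph V Ed) (x : E.PreAlg) :
    ‖of E x‖ = ‖x‖ :=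
  UniformSpace.Completion.norm_coe x

theorem denseRange_of {V : Type u} {Ed : Type v} (E : RowFiniteGraph V Ed) :
    DenseRange (of E) :=
  UniformSpace.Completion.denseRange_coe

theorem continuous_of {V : Type u} {Ed : Type v} (E : RowFiniteGraph V Ed) :
    Continuous (of E) :=
  UniformSpace.Completion.continuous_coe _

/-- The involution, extended by continuity. -/
noncomputable instance {V : Type u} {Ed : Type v} (E : RowFiniteGraph V Ed) :
    Star E.UnitalAlg where
  star := UniformSpace.Completion.map (star : E.PreAlg → E.PreAlg)

theorem star_of {V : Type u} {Ed : Type v} (E : RowFiniteGraph V Ed) (x : E.PreAlg) :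
    star (of E x) = of E (star x) :=
  UniformSpace.Completion.map_coe (starNormedAddGroupHom (E := E.PreAlg)).uniformContinuous x

theorem continuous_star' {V : Type u} {Ed : Type v} (E : RowFiniteGraph V Ed) :
    Continuous (star : E.UnitalAlg → E.UnitalAlg) :=
  UniformSpace.Completion.continuous_map

theorem induction {V : Type u} {Ed : Type v} {E : RowFiniteGraph V Ed}
    {motive : E.UnitalAlg → Prop} (x : E.UnitalAlg) (hc : IsClosed {x | motive x})
    (h : ∀ x, motive (of E x)) : motive x :=
  (denseRange_of E).induction_on x hc h

noncomputable instance {V : Type u} {Ed : Type v} (E : RowFiniteGraph V Ed) :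
    StarRing E.UnitalAlg where
  star_involutive x := by
    have hs := continuous_star' E
    induction x using induction with
    | hc => exact isClosed_eq (hs.comp hs) continuous_id
    | h x => rw [star_of, star_of, star_star]
  star_add x y := by
    have hs := continuous_star' E
    induction x using induction with
    | hc => exact isClosed_eq (hs.comp (by fun_prop)) (hs.add continuous_const)
    | h x =>
      induction y using induction with
      | hc => exact isClosed_eq (hs.comp (by fun_prop)) (continuous_const.add hs)
      | h y => rw [← map_add, star_of, star_of, star_of, star_add, map_add]
  star_mul x y := by
    have hs := continuous_star' E
    induction x using induction with
    | hc => exact isClosed_eq (hs.comp (by fun_prop)) (continuous_const.mul hs)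
    | h x =>
      induction y using induction with
      | hc => exact isClosed_eq (hs.comp (by fun_prop)) (hs.mul continuous_const)
      | h y => rw [← map_mul, star_of, star_of, star_of, star_mul, map_mul]

theorem star_smul' {V : Type u} {Ed : Type v} (E : RowFiniteGraph V Ed) (c : ℂ)
    (x : E.UnitalAlg) : star (c • x) = star c • star x := by
  have hs := continuous_star' E
  induction x using induction with
  | hc =>
    exact isClosed_eq (hs.comp (continuous_const_smul c)) ((continuous_const_smul (star c)).comp hs)
  | h x => rw [← of_smul, star_of, star_smul, of_smul, star_of]

noncomputable instance {V : Type u} {Ed : Type v} (E : RowFiniteGraph V Ed) :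
    CStarAlgebra E.UnitalAlg where
  norm_mul_self_le x := by
    have hs := continuous_star' E
    induction x using induction with
    | hc => exact isClosed_le (by fun_prop) ((hs.mul continuous_id).norm)
    | h x =>
      rw [star_of, ← map_mul, norm_of, norm_of]
      exact ((PreAlg.isCKSeminorm_univSeminorm E).star_mul_self x).ge
  star_smul := star_smul' E

end UnitalAlg

/-- The vertex projections in the unital algebra. -/
noncomputable def UnitalAlg.p {V : Type u} {Ed : Type v} (E : RowFiniteGraph V Ed) (x : V) :
    E.UnitalAlg :=
  UnitalAlg.of E (PreAlg.gp E x)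

/-- The partial isometries of the edges in the unital algebra. -/
noncomputable def UnitalAlg.s {V : Type u} {Ed : Type v} (E : RowFiniteGraph V Ed) (e : Ed) :
    E.UnitalAlg :=
  UnitalAlg.of E (PreAlg.gs E e)

theorem UnitalAlg.of_relator {V : Type u} {Ed : Type v} {E : RowFiniteGraph V Ed}
    {x : E.PreAlg} (hx : PreAlg.Relator E x) : UnitalAlg.of E x = 0 := by
  rw [← norm_eq_zero, UnitalAlg.norm_of]
  exact (PreAlg.isCKSeminorm_univSeminorm E).relator x hx

theorem UnitalAlg.isCKFamily {V : Type u} {Ed : Type v} (E : RowFiniteGraph V Ed) :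
    E.IsCKFamily (UnitalAlg.p E) (UnitalAlg.s E) where
  star_p x := by
    have h := UnitalAlg.of_relator (PreAlg.Relator.star_p (E := E) x)
    rw [map_sub, sub_eq_zero] at h
    rw [UnitalAlg.p, UnitalAlg.star_of, h]
  p_mul_self x := by
    have h := UnitalAlg.of_relator (PreAlg.Relator.p_mul_self (E := E) x)
    rwa [map_sub, sub_eq_zero, map_mul] at h
  p_mul_p x y hxy := by
    have h := UnitalAlg.of_relator (PreAlg.Relator.p_mul_p (E := E) x y hxy)
    rwa [map_mul] at h
  star_s_mul_s e := by
    have h := UnitalAlg.of_relator (PreAlg.Relator.star_s_mul_s (E := E) e)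
    rwa [map_sub, sub_eq_zero, map_mul, ← UnitalAlg.star_of] at h
  p_mul_s e := by
    have h := UnitalAlg.of_relator (PreAlg.Relator.p_mul_s (E := E) e)
    rwa [map_sub, sub_eq_zero, map_mul] at h
  sum_s x hx := by
    have h := UnitalAlg.of_relator (PreAlg.Relator.sum_s (E := E) x hx)
    simp only [map_sub, sub_eq_zero, map_sum, map_mul, ← UnitalAlg.star_of] at h
    exact h

/-- `C*(E)` as a subalgebra: the closed (non-unital) `*`-subalgebra generated by the universal
Cuntz–Krieger family. -/
noncomputable def cstarSub {V : Type u} {Ed : Type v} (E : RowFiniteGraph V Ed) :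
    NonUnitalStarSubalgebra ℂ E.UnitalAlg :=
  (NonUnitalStarAlgebra.adjoin ℂ
    (Set.range (UnitalAlg.p E) ∪ Set.range (UnitalAlg.s E))).topologicalClosure

/-- The graph `C*`-algebra `C*(E)`. -/
def CStarAlg {V : Type u} {Ed : Type v} (E : RowFiniteGraph V Ed) : Type (max u v) :=
  E.cstarSub

theorem isClosed_cstarSub {V : Type u} {Ed : Type v} (E : RowFiniteGraph V Ed) :
    IsClosed (E.cstarSub : Set E.UnitalAlg) :=
  NonUnitalStarSubalgebra.isClosed_topologicalClosure _

noncomputable instance {V : Type u} {Ed : Type v} (E : RowFiniteGraph V Ed) :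
    NonUnitalCStarAlgebra E.CStarAlg :=
  NonUnitalStarSubalgebra.nonUnitalCStarAlgebra E.cstarSub (h_closed := E.isClosed_cstarSub)

/-- The inclusion of `C*(E)` in the unital algebra. -/
noncomputable def incl {V : Type u} {Ed : Type v} (E : RowFiniteGraph V Ed) :
    E.CStarAlg →⋆ₙₐ[ℂ] E.UnitalAlg where
  toFun a := a.1
  map_smul' _ _ := rfl
  map_zero' := rfl
  map_add' _ _ := rfl
  map_mul' _ _ := rfl
  map_star' _ := rfl

theorem incl_injective {V : Type u} {Ed : Type v} (E : RowFiniteGraph V Ed) :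
    Function.Injective E.incl :=
  Subtype.val_injective

theorem isometry_incl {V : Type u} {Ed : Type v} (E : RowFiniteGraph V Ed) :
    Isometry E.incl :=
  fun _ _ => rfl

theorem incl_mem_closure {V : Type u} {Ed : Type v} (E : RowFiniteGraph V Ed) (a : E.CStarAlg) :
    E.incl a ∈ closure (NonUnitalStarAlgebra.adjoin ℂ
      (Set.range (UnitalAlg.p E) ∪ Set.range (UnitalAlg.s E)) : Set E.UnitalAlg) :=
  a.2

/-- The canonical projection `p x` of `C*(E)`. -/
noncomputable def p {V : Type u} {Ed : Type v} (E : RowFiniteGraph V Ed) (x : V) : E.CStarAlg :=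
  ⟨UnitalAlg.p E x, NonUnitalStarSubalgebra.le_topologicalClosure _
    (NonUnitalStarAlgebra.subset_adjoin ℂ _ (Or.inl ⟨x, rfl⟩))⟩

/-- The canonical partial isometry of an edge, in `C*(E)`. -/
noncomputable def se {V : Type u} {Ed : Type v} (E : RowFiniteGraph V Ed) (e : Ed) : E.CStarAlg :=
  ⟨UnitalAlg.s E e, NonUnitalStarSubalgebra.le_topologicalClosure _
    (NonUnitalStarAlgebra.subset_adjoin ℂ _ (Or.inr ⟨e, rfl⟩))⟩

theorem isCKFamily {V : Type u} {Ed : Type v} (E : RowFiniteGraph V Ed) :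
    E.IsCKFamily E.p E.se where
  star_p x := E.incl_injective ((UnitalAlg.isCKFamily E).star_p x)
  p_mul_self x := E.incl_injective ((UnitalAlg.isCKFamily E).p_mul_self x)
  p_mul_p x y h := E.incl_injective ((UnitalAlg.isCKFamily E).p_mul_p x y h)
  star_s_mul_s e := E.incl_injective ((UnitalAlg.isCKFamily E).star_s_mul_s e)
  p_mul_s e := E.incl_injective ((UnitalAlg.isCKFamily E).p_mul_s e)
  sum_s x h := E.incl_injective (by
    rw [map_sum]
    exact (UnitalAlg.isCKFamily E).sum_s x h)

/-! ### The universal property -/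

/-- The homomorphism from the free `*`-algebra given by elements of a unital `*`-algebra. -/
noncomputable def preLift {V : Type u} {Ed : Type v} (E : RowFiniteGraph V Ed) {B : Type w}
    [CStarAlgebra B] (P : V → B) (S : Ed → B) : E.PreAlg →ₐ[ℂ] B :=
  MonoidAlgebra.lift ℂ B (FreeMonoid (Gen V Ed)) (FreeMonoid.lift fun g => match g with
    | .p x => P x
    | .s e => S e
    | .sAdj e => star (S e)
    | .pAdj x => star (P x))

theorem preLift_mono {V : Type u} {Ed : Type v} (E : RowFiniteGraph V Ed) {B : Type w}
    [CStarAlgebra B] (P : V → B) (S : Ed → B) (m : FreeMonoid (Gen V Ed)) (c : ℂ) :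
    E.preLift P S (PreAlg.mono E m c) = c • FreeMonoid.lift (fun g : Gen V Ed => match g with
    | .p x => P x
    | .s e => S e
    | .sAdj e => star (S e)
    | .pAdj x => star (P x)) m :=
  MonoidAlgebra.lift_single _ m c

theorem preLift_gp {V : Type u} {Ed : Type v} (E : RowFiniteGraph V Ed) {B : Type w}
    [CStarAlgebra B] (P : V → B) (S : Ed → B) (x : V) : E.preLift P S (PreAlg.gp E x) = P x := by
  simp [PreAlg.gp, preLift_mono]

theorem preLift_gs {V : Type u} {Ed : Type v} (E : RowFiniteGraph V Ed) {B : Type w}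
    [CStarAlgebra B] (P : V → B) (S : Ed → B) (e : Ed) : E.preLift P S (PreAlg.gs E e) = S e := by
  simp [PreAlg.gs, preLift_mono]

theorem preLift_star {V : Type u} {Ed : Type v} (E : RowFiniteGraph V Ed) {B : Type w}
    [CStarAlgebra B] (P : V → B) (S : Ed → B) (x : E.PreAlg) :
    E.preLift P S (star x) = star (E.preLift P S x) := by
  induction x using PreAlg.induction_linear with
  | zero => simp
  | add x y hx hy => rw [star_add, map_add, hx, hy, map_add, star_add]
  | mono m c =>
    rw [PreAlg.star_mono, preLift_mono, preLift_mono, star_smul]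
    congr 1
    induction m using FreeMonoid.inductionOn' with
    | one => simp [wordAdj]
    | of_mul g m ih =>
      rw [wordAdj_mul, map_mul, map_mul, star_mul, ih]
      congr 1
      cases g <;> simp [wordAdj, Gen.adj]

theorem isCKSeminorm_preLift {V : Type u} {Ed : Type v} {E : RowFiniteGraph V Ed} {B : Type w}
    [CStarAlgebra B] {P : V → B} {S : Ed → B} (h : E.IsCKFamily P S) :
    PreAlg.IsCKSeminorm E ((normSeminorm ℂ B).comp (E.preLift P S).toLinearMap) where
  mul_le x y := by simpa using norm_mul_le (E.preLift P S x) (E.preLift P S y)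
  star_mul_self x := by simp [preLift_star, CStarRing.norm_star_mul_self]
  relator x hx := by
    have key : E.preLift P S x = 0 := by
      induction hx with
      | star_p x => simp [preLift_star, preLift_gp, h.star_p]
      | p_mul_self x => simp [preLift_gp, h.p_mul_self]
      | p_mul_p x y hxy => simp [preLift_gp, h.p_mul_p x y hxy]
      | star_s_mul_s e => simp [preLift_star, preLift_gp, preLift_gs, h.star_s_mul_s]
      | p_mul_s e => simp [preLift_gp, preLift_gs, h.p_mul_s]
      | sum_s x hx => simp [preLift_star, preLift_gp, preLift_gs, h.sum_s x hx]
    simp [key]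

theorem norm_preLift_le {V : Type u} {Ed : Type v} {E : RowFiniteGraph V Ed} {B : Type w}
    [CStarAlgebra B] {P : V → B} {S : Ed → B} (h : E.IsCKFamily P S) (x : E.PreAlg) :
    ‖E.preLift P S x‖ ≤ ‖x‖ :=
  PreAlg.le_univNorm (isCKSeminorm_preLift h) x

theorem continuous_preLift {V : Type u} {Ed : Type v} {E : RowFiniteGraph V Ed} {B : Type w}
    [CStarAlgebra B] {P : V → B} {S : Ed → B} (h : E.IsCKFamily P S) :
    Continuous (E.preLift P S) :=
  AddMonoidHomClass.continuous_of_bound (E.preLift P S) 1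
    (by simpa using norm_preLift_le h)
theorem exists_unitalLift {V : Type u} {Ed : Type v} {E : RowFiniteGraph V Ed} {B : Type w}
    [CStarAlgebra B] {P : V → B} {S : Ed → B} (h : E.IsCKFamily P S) :
    ∃ φ : E.UnitalAlg →⋆ₐ[ℂ] B, (∀ x, φ (UnitalAlg.p E x) = P x) ∧
      ∀ e, φ (UnitalAlg.s E e) = S e := by
  have hu : UniformContinuous (E.preLift P S) :=
    uniformContinuous_addMonoidHom_of_continuous (continuous_preLift h)
  let f : E.UnitalAlg → B := UniformSpace.Completion.extension (E.preLift P S)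
  have hf : Continuous f := UniformSpace.Completion.continuous_extension
  have hof : ∀ x, f (UnitalAlg.of E x) = E.preLift P S x :=
    UniformSpace.Completion.extension_coe hu
  have hs := UnitalAlg.continuous_star' E
  have hsmul : ∀ (c : ℂ) (x : E.UnitalAlg), f (c • x) = c • f x := by
    intro c x
    induction x using UnitalAlg.induction with
    | hc => exact isClosed_eq (hf.comp (continuous_const_smul c)) (hf.const_smul c)
    | h x => rw [← UnitalAlg.of_smul, hof, hof, map_smul]
  have hone : f 1 = 1 := by rw [← map_one (UnitalAlg.of E), hof, map_one]
  let φ : E.UnitalAlg →⋆ₐ[ℂ] B :=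
    { toFun := f
      map_one' := hone
      map_mul' := fun x y => by
        induction x using UnitalAlg.induction with
        | hc => exact isClosed_eq (hf.comp (by fun_prop)) (hf.mul continuous_const)
        | h x =>
          induction y using UnitalAlg.induction with
          | hc => exact isClosed_eq (hf.comp (by fun_prop)) (continuous_const.mul hf)
          | h y => rw [← map_mul, hof, hof, hof, map_mul]
      map_zero' := by rw [← map_zero (UnitalAlg.of E), hof, map_zero]
      map_add' := fun x y => by
        induction x using UnitalAlg.induction with
        | hc => exact isClosed_eq (hf.comp (by fun_prop)) (hf.add continuous_const)
        | h x =>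
          induction y using UnitalAlg.induction with
          | hc => exact isClosed_eq (hf.comp (by fun_prop)) (continuous_const.add hf)
          | h y => rw [← map_add, hof, hof, hof, map_add]
      commutes' := fun c => by
        rw [Algebra.algebraMap_eq_smul_one, hsmul, hone, Algebra.algebraMap_eq_smul_one]
      map_star' := fun x => by
        induction x using UnitalAlg.induction with
        | hc => exact isClosed_eq (hf.comp hs) hf.star
        | h x => rw [UnitalAlg.star_of, hof, hof, preLift_star] }
  refine ⟨φ, fun x => ?_, fun e => ?_⟩
  · exact (hof _).trans (preLift_gp E P S x)
  · exact (hof _).trans (preLift_gs E P S e)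

/-- Two `*`-homomorphisms on `C*(E)` that agree on the generators are equal. -/
theorem hom_ext {V : Type u} {Ed : Type v} {E : RowFiniteGraph V Ed} {B : Type w}
    [NonUnitalCStarAlgebra B] {φ ψ : E.CStarAlg →⋆ₙₐ[ℂ] B} (hp : ∀ x, φ (E.p x) = ψ (E.p x))
    (hs : ∀ e, φ (E.se e) = ψ (E.se e)) : φ = ψ := by
  have hφ : Continuous φ := AddMonoidHomClass.continuous_of_bound φ 1
    (by simpa using NonUnitalStarAlgHom.norm_apply_le φ)
  have hψ : Continuous ψ := AddMonoidHomClass.continuous_of_bound ψ 1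
    (by simpa using NonUnitalStarAlgHom.norm_apply_le ψ)
  have key : ∀ a ∈ NonUnitalStarAlgebra.adjoin ℂ
      (Set.range (UnitalAlg.p E) ∪ Set.range (UnitalAlg.s E)),
      ∃ b : E.CStarAlg, φ b = ψ b ∧ E.incl b = a := by
    intro a ha
    induction ha using NonUnitalStarAlgebra.adjoin_induction with
    | mem x hx =>
      rcases hx with ⟨x, rfl⟩ | ⟨e, rfl⟩
      · exact ⟨E.p x, hp x, rfl⟩
      · exact ⟨E.se e, hs e, rfl⟩
    | add x y hx hy h1 h2 =>
      obtain ⟨b, hb, rfl⟩ := h1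
      obtain ⟨c, hc, rfl⟩ := h2
      exact ⟨b + c, by rw [map_add, map_add, hb, hc], map_add _ _ _⟩
    | zero => exact ⟨0, by rw [map_zero, map_zero], map_zero _⟩
    | mul x y hx hy h1 h2 =>
      obtain ⟨b, hb, rfl⟩ := h1
      obtain ⟨c, hc, rfl⟩ := h2
      exact ⟨b * c, by rw [map_mul, map_mul, hb, hc], map_mul _ _ _⟩
    | smul c x hx h1 =>
      obtain ⟨b, hb, rfl⟩ := h1
      exact ⟨c • b, by rw [map_smul, map_smul, hb], map_smul _ _ _⟩
    | star x hx h1 =>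
      obtain ⟨b, hb, rfl⟩ := h1
      exact ⟨star b, by rw [map_star, map_star, hb], map_star _ _⟩
  ext a
  have hcl : IsClosed {a : E.CStarAlg | φ a = ψ a} := isClosed_eq hφ hψ
  have hmem : a ∈ closure {a : E.CStarAlg | φ a = ψ a} := by
    rw [E.isometry_incl.isUniformInducing.isInducing.closure_eq_preimage_closure_image]
    exact closure_mono (fun b hb => key b hb) (E.incl_mem_closure a)
  rwa [hcl.closure_eq] at hmem

/-- Universal property: a Cuntz–Krieger `E`-family in an arbitrary `C*`-algebra is the image of the
canonical one under a `*`-homomorphism (which is unique by `hom_ext`). -/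
theorem exists_lift {V : Type u} {Ed : Type v} {E : RowFiniteGraph V Ed} {B : Type w}
    [NonUnitalCStarAlgebra B] {P : V → B} {S : Ed → B} (h : E.IsCKFamily P S) :
    ∃ φ : E.CStarAlg →⋆ₙₐ[ℂ] B, (∀ x, φ (E.p x) = P x) ∧ ∀ e, φ (E.se e) = S e := by
  let ι : B →⋆ₙₐ[ℂ] Unitization ℂ B := Unitization.inrNonUnitalStarAlgHom ℂ B
  have h' : E.IsCKFamily (fun x => ι (P x)) (fun e => ι (S e)) :=
    { star_p := fun x => by rw [← map_star, h.star_p]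
      p_mul_self := fun x => by rw [← map_mul, h.p_mul_self]
      p_mul_p := fun x y hxy => by rw [← map_mul, h.p_mul_p x y hxy, map_zero]
      star_s_mul_s := fun e => by rw [← map_star, ← map_mul, h.star_s_mul_s]
      p_mul_s := fun e => by rw [← map_mul, h.p_mul_s]
      sum_s := fun x hx => by rw [← h.sum_s x hx, map_sum]; simp only [map_mul, map_star] }
  obtain ⟨Φ, hP, hS⟩ := exists_unitalLift h'
  let φ : E.CStarAlg →⋆ₙₐ[ℂ] Unitization ℂ B :=
    (Φ : E.UnitalAlg →⋆ₙₐ[ℂ] Unitization ℂ B).comp E.incl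
  have hφP : ∀ x, φ (E.p x) = ι (P x) := hP
  have hφS : ∀ e, φ (E.se e) = ι (S e) := hS
  let χ : Unitization ℂ B →⋆ₙₐ[ℂ] ℂ :=
    { toFun := fun b => b.fst
      map_smul' := fun c b => by simp
      map_zero' := by simp
      map_add' := fun b c => by simp
      map_mul' := fun b c => by simp
      map_star' := fun b => by simp }
  have hχ : χ.comp φ = 0 := by
    apply hom_ext
    · intro x; change (φ (E.p x)).fst = 0; rw [hφP]; simp [ι]
    · intro e; change (φ (E.se e)).fst = 0; rw [hφS]; simp [ι]
  have hfst : ∀ a, (φ a).fst = 0 := fun a => DFunLike.congr_fun hχ a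
  refine ⟨{ toFun := fun a => (φ a).snd
            map_smul' := fun c a => by simp
            map_zero' := by simp
            map_add' := fun a b => by simp
            map_mul' := fun a b => by simp [hfst]
            map_star' := fun a => by simp [map_star] }, fun x => ?_, fun e => ?_⟩
  · change (φ (E.p x)).snd = P x; rw [hφP]; simp [ι]
  · change (φ (E.se e)).snd = S e; rw [hφS]; simp [ι]

/-- The family `p x`, `z s e` for `z` in the circle. -/
theorem isCKFamily_gauge {V : Type u} {Ed : Type v} (E : RowFiniteGraph V Ed) (z : Circle) :
    E.IsCKFamily E.p (fun e => (z : ℂ) • E.se e) := by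
  have hz : star (z : ℂ) * (z : ℂ) = 1 := by
    rw [Complex.star_def, ← Circle.coe_inv_eq_conj, ← Circle.coe_mul]; simp
  have h := E.isCKFamily
  exact
    { star_p := h.star_p
      p_mul_self := h.p_mul_self
      p_mul_p := h.p_mul_p
      star_s_mul_s := fun e => by
        rw [star_smul, smul_mul_smul_comm, hz, one_smul, h.star_s_mul_s]
      p_mul_s := fun e => by rw [mul_smul_comm, h.p_mul_s]
      sum_s := fun x hx => by
        rw [← h.sum_s x hx]
        refine Finset.sum_congr rfl fun e _ => ?_
        rw [star_smul, smul_mul_smul_comm, mul_comm, hz, one_smul] }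

/-- The gauge action: `γ_z` is the `*`-endomorphism of `C*(E)` with `γ_z (p x) = p x` and
`γ_z (s e) = z s e`. -/
noncomputable def gauge {V : Type u} {Ed : Type v} (E : RowFiniteGraph V Ed) (z : Circle) :
    E.CStarAlg →⋆ₙₐ[ℂ] E.CStarAlg :=
  (exists_lift (E.isCKFamily_gauge z)).choose

theorem gauge_p {V : Type u} {Ed : Type v} (E : RowFiniteGraph V Ed) (z : Circle) (x : V) :
    E.gauge z (E.p x) = E.p x :=
  (exists_lift (E.isCKFamily_gauge z)).choose_spec.1 x

theorem gauge_se {V : Type u} {Ed : Type v} (E : RowFiniteGraph V Ed) (z : Circle) (e : Ed) :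
    E.gauge z (E.se e) = (z : ℂ) • E.se e :=
  (exists_lift (E.isCKFamily_gauge z)).choose_spec.2 e

end RowFiniteGraph

/-! ### Closed ideals and regular ideals -/

/-- A closed two-sided ideal of a `C*`-algebra. -/
structure ClosedIdeal (A : Type u) [NonUnitalCStarAlgebra A] extends Submodule ℂ A where
  mul_mem_left' : ∀ (a : A) {x : A}, x ∈ carrier → a * x ∈ carrier
  mul_mem_right' : ∀ (a : A) {x : A}, x ∈ carrier → x * a ∈ carrier
  isClosed' : IsClosed carrier

/-- `X^⊥`, the two-sided annihilator of a set. -/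
def annihilatorSet {A : Type u} [NonUnitalCStarAlgebra A] (X : Set A) : Set A :=
  {a | ∀ x ∈ X, a * x = 0 ∧ x * a = 0}

namespace ClosedIdeal

/-- An ideal is regular if `J = J^⊥⊥`. -/
def IsRegular {A : Type u} [NonUnitalCStarAlgebra A] (J : ClosedIdeal A) : Prop :=
  J.carrier = annihilatorSet (annihilatorSet J.carrier)

/-- Closed two-sided ideals are self-adjoint. -/
theorem star_mem {A : Type u} [NonUnitalCStarAlgebra A] (J : ClosedIdeal A) {a : A}
    (ha : a ∈ J.toSubmodule) : star a ∈ J.toSubmodule := by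
  let B : NonUnitalStarSubalgebra ℂ A :=
    { carrier := {x | x ∈ J.toSubmodule ∧ star x ∈ J.toSubmodule}
      add_mem' := fun {x y} hx hy =>
        ⟨add_mem hx.1 hy.1, by rw [star_add]; exact add_mem hx.2 hy.2⟩
      zero_mem' := ⟨zero_mem _, by rw [star_zero]; exact zero_mem _⟩
      mul_mem' := fun {x y} hx hy =>
        ⟨J.mul_mem_left' x hy.1, by rw [star_mul]; exact J.mul_mem_left' _ hx.2⟩
      smul_mem' := fun c {x} hx =>
        ⟨J.toSubmodule.smul_mem c hx.1, by
          rw [star_smul]; exact J.toSubmodule.smul_mem _ hx.2⟩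
      star_mem' := fun {x} hx => ⟨hx.2, by rw [star_star]; exact hx.1⟩ }
  have hB : IsClosed (B : Set A) :=
    IsClosed.inter (J.isClosed' : IsClosed {x | x ∈ J.toSubmodule})
      (IsClosed.preimage continuous_star J.isClosed')
  let _ : NonUnitalCStarAlgebra B :=
    NonUnitalStarSubalgebra.nonUnitalCStarAlgebra B (h_closed := hB)
  let _ : PartialOrder B := CStarAlgebra.spectralOrder B
  have : StarOrderedRing B := CStarAlgebra.spectralOrderedRing B
  have hb : a * star a ∈ B := by
    refine ⟨J.mul_mem_right' _ ha, ?_⟩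
    rw [star_mul, star_star]
    exact J.mul_mem_right' _ ha
  let b : B := ⟨a * star a, hb⟩
  have hl := CStarAlgebra.increasingApproximateUnit B
  have := hl.neBot
  have h1 : Filter.Tendsto (fun w : B => b * w) (CStarAlgebra.approximateUnit B) (nhds b) :=
    hl.tendsto_mul_left b
  have h2 : Filter.Tendsto (fun w : B => w * b) (CStarAlgebra.approximateUnit B) (nhds b) :=
    hl.tendsto_mul_right b
  have hnorm : Filter.Tendsto (fun w : B => ‖star a - star a * (w : A)‖)
      (CStarAlgebra.approximateUnit B) (nhds 0) := by
    have h3 : Filter.Tendsto (fun w : B => 2 * ‖b - b * w‖)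
        (CStarAlgebra.approximateUnit B) (nhds 0) := by
      have h5 : Filter.Tendsto (fun w : B => b - b * w)
          (CStarAlgebra.approximateUnit B) (nhds (b - b)) := tendsto_const_nhds.sub h1
      have h6 := h5.norm.const_mul (2 : ℝ)
      simpa using h6
    have h4 : Filter.Tendsto (fun w : B => Real.sqrt (2 * ‖b - b * w‖))
        (CStarAlgebra.approximateUnit B) (nhds 0) := by
      simpa using h3.sqrt
    refine tendsto_of_tendsto_of_tendsto_of_le_of_le' tendsto_const_nhds h4
      (Filter.Eventually.of_forall fun w => norm_nonneg _) ?_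
    filter_upwards [hl.eventually_norm, hl.eventually_star_eq] with w hw hws
    refine Real.le_sqrt_of_sq_le ?_
    have hws' : star (w : A) = w := congrArg Subtype.val hws
    have e : star (star a - star a * (w : A)) * (star a - star a * (w : A)) =
        ((b - b * w : B) : A) - (w : A) * ((b - b * w : B) : A) := by
      simp only [star_sub, star_mul, star_star, hws', b]
      push_cast
      noncomm_ring
    rw [sq, ← CStarRing.norm_star_mul_self, e]
    have hw' : ‖(w : A)‖ ≤ 1 := hw
    calc _ ≤ ‖((b - b * w : B) : A)‖ + ‖(w : A)‖ * ‖((b - b * w : B) : A)‖ :=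
          (norm_sub_le _ _).trans (by gcongr; exact norm_mul_le _ _)
      _ ≤ ‖((b - b * w : B) : A)‖ + 1 * ‖((b - b * w : B) : A)‖ := by gcongr
      _ = 2 * ‖b - b * w‖ := by
        change ‖b - b * w‖ + 1 * ‖b - b * w‖ = _
        ring
  have hlim : Filter.Tendsto (fun w : B => star a * (w : A))
      (CStarAlgebra.approximateUnit B) (nhds (star a)) := by
    rw [tendsto_iff_norm_sub_tendsto_zero]
    simpa only [norm_sub_rev] using hnorm
  exact J.isClosed'.mem_of_tendsto hlim
    (Filter.Eventually.of_forall fun w => J.mul_mem_left' _ w.2.1)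

/-- The quotient of a `C*`-algebra by a closed ideal, a `*`-algebra over `ℂ`. -/
def Quotient {A : Type u} [NonUnitalCStarAlgebra A] (J : ClosedIdeal A) : Type u :=
  A ⧸ J.toSubmodule

noncomputable instance {A : Type u} [NonUnitalCStarAlgebra A] (J : ClosedIdeal A) :
    AddCommGroup J.Quotient :=
  inferInstanceAs (AddCommGroup (A ⧸ J.toSubmodule))

noncomputable instance {A : Type u} [NonUnitalCStarAlgebra A] (J : ClosedIdeal A) :
    Module ℂ J.Quotient :=
  inferInstanceAs (Module ℂ (A ⧸ J.toSubmodule))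

/-- The quotient map. -/
def toQuot {A : Type u} [NonUnitalCStarAlgebra A] (J : ClosedIdeal A) : A →ₗ[ℂ] J.Quotient :=
  J.toSubmodule.mkQ

theorem toQuot_eq {A : Type u} [NonUnitalCStarAlgebra A] (J : ClosedIdeal A) {a b : A} :
    J.toQuot a = J.toQuot b ↔ a - b ∈ J.toSubmodule :=
  Submodule.Quotient.eq J.toSubmodule

theorem toQuot_surjective {A : Type u} [NonUnitalCStarAlgebra A] (J : ClosedIdeal A) :
    Function.Surjective J.toQuot :=
  Submodule.mkQ_surjective J.toSubmodule

/-- The product of classes is the class of the product. -/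
instance {A : Type u} [NonUnitalCStarAlgebra A] (J : ClosedIdeal A) : Mul J.Quotient where
  mul := Quotient.map₂ (· * ·) fun a a' ha b b' hb => by
    have ha' : a - a' ∈ J.toSubmodule := J.toQuot_eq.1 (Quotient.sound ha)
    have hb' : b - b' ∈ J.toSubmodule := J.toQuot_eq.1 (Quotient.sound hb)
    refine Quotient.exact (J.toQuot_eq.2 ?_)
    have e : a * b - a' * b' = (a - a') * b + a' * (b - b') := by noncomm_ring
    rw [e]
    exact add_mem (J.mul_mem_right' b ha') (J.mul_mem_left' a' hb')

/-- The adjoint of a class is the class of the adjoint. -/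
instance {A : Type u} [NonUnitalCStarAlgebra A] (J : ClosedIdeal A) : Star J.Quotient where
  star := Quotient.map star fun a a' ha => by
    have ha' : a - a' ∈ J.toSubmodule := J.toQuot_eq.1 (Quotient.sound ha)
    refine Quotient.exact (J.toQuot_eq.2 ?_)
    rw [← star_sub]
    exact J.star_mem ha'

theorem toQuot_mul {A : Type u} [NonUnitalCStarAlgebra A] (J : ClosedIdeal A) (a b : A) :
    J.toQuot (a * b) = J.toQuot a * J.toQuot b := rfl

theorem toQuot_star {A : Type u} [NonUnitalCStarAlgebra A] (J : ClosedIdeal A) (a : A) :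
    J.toQuot (star a) = star (J.toQuot a) := rfl

end ClosedIdeal

namespace RowFiniteGraph

/-- An ideal of `C*(E)` is gauge-invariant if every `γ_z` maps it into itself. -/
def GaugeInvariant {V : Type u} {Ed : Type v} (E : RowFiniteGraph V Ed)
    (J : ClosedIdeal E.CStarAlg) : Prop :=
  ∀ (z : Circle), ∀ a ∈ J.carrier, E.gauge z a ∈ J.carrier

/-- `H(J)`, the set of vertices whose projections lie in `J`. -/
def vertexSet {V : Type u} {Ed : Type v} (E : RowFiniteGraph V Ed) (J : ClosedIdeal E.CStarAlg) :
    Set V :=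
  {x | E.p x ∈ J.carrier}

theorem vertexSet_hereditary {V : Type u} {Ed : Type v} (E : RowFiniteGraph V Ed)
    (J : ClosedIdeal E.CStarAlg) (e : Ed) (he : E.r e ∈ E.vertexSet J) :
    E.s e ∈ E.vertexSet J := by
  change E.p (E.s e) ∈ J.carrier
  rw [← E.isCKFamily.star_s_mul_s e, ← E.isCKFamily.p_mul_s e]
  exact J.mul_mem_left' _ (J.mul_mem_right' _ he)

/-- The quotient graph `E/J`: delete the vertices in `H(J)` and the edges with source in `H(J)`
(the remaining edges have their range outside `H(J)` because `H(J)` is hereditary). -/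
def quotientGraph {V : Type u} {Ed : Type v} (E : RowFiniteGraph V Ed)
    (J : ClosedIdeal E.CStarAlg) :
    RowFiniteGraph {x : V // x ∉ E.vertexSet J} {e : Ed // E.s e ∉ E.vertexSet J} where
  r e := ⟨E.r e.1, fun h => e.2 (E.vertexSet_hereditary J e.1 h)⟩
  s e := ⟨E.s e.1, e.2⟩
  finite_fiber x := by
    refine Set.Finite.subset
      (Set.Finite.preimage Subtype.val_injective.injOn (E.finite_fiber x.1)) ?_
    intro e he
    exact congrArg Subtype.val he

end RowFiniteGraph

/-! The isomorphism rests on the gauge-invariant uniqueness theorem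
(`injective_of_gauge_invariant`): a homomorphism on a graph algebra that kills no vertex projection
and has a gauge-invariant kernel is injective. Averaging over the circle gives a faithful
contractive expectation whose values are limits of elements of the core, the span of `s_μ s_ν*` with
`|μ| = |ν|`. Each core element lies in a finite-dimensional `*`-algebra spanned by matrix units
whose diagonal corners are multiples of vertex projections, so such a homomorphism is isometric on
the core. Applied to the map from the algebra of `E/J` to `C*(E)/J`, whose image contains the
classes of all monomials `s_μ s_ν*`, this gives an isomorphism.

Condition (L) is where regularity enters. Suppose that a cycle of `E/J` has no entry there, and
unroll it into a periodic infinite path `β` of `E`, followed against the direction of its edges; let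
`w` be its first vertex. Any other edge of `E` into a vertex of `β` has its source in `H(J)`, so its
partial isometry lies in `J`. Condition (L) for `E` supplies such edges arbitrarily far along `β`.
Let `t` be the product of a long initial segment of `β`. An element `b` of `J^⊥` in the corner of
`p_w` kills all the side branches, so `b = t t* b t t*`. If `b` is also a limit of core elements,
then `t* b t` is close to a multiple `c p` of a vertex projection; a side branch `e` at that vertex
gives `t* b t s_e = 0`, which forces `c` to be small. Hence `b = 0` (`eq_zero_of_mem_annihilator`).
Taking for `b` the expectation of `(a p_w)* (a p_w)` with `a ∈ J^⊥` gives `a p_w = 0`, so `p_w ∈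
J^⊥⊥ = J`, although `w` is a vertex of `E/J` (`mem_vertexSet_of_path`).

Two foundations are also needed: the quotient of a `C*`-algebra by a closed ideal is a `C*`-algebra,
and the vertex projections of a graph algebra do not vanish, which is seen in a representation on
`ℓ²`. -/

namespace ClosedIdeal

/-! ### Quotients of `C*`-algebras by closed ideals. -/

/-- A closed ideal contains self-adjoint approximate right units `w` for each of its elements, with
`‖1 - w‖ ≤ 1`. -/
theorem exists_local_unit {A : Type u} [NonUnitalCStarAlgebra A] (J : ClosedIdeal A) {j : A}
    (hj : j ∈ J.toSubmodule) {ε : ℝ} (hε : 0 < ε) :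
    ∃ w ∈ J.toSubmodule, star w = w ∧ ‖(1 : Unitization ℂ A) - (w : Unitization ℂ A)‖ ≤ 1 ∧
      ‖j - j * w‖ ≤ ε := by
  let B : NonUnitalStarSubalgebra ℂ A :=
    { J.toSubmodule with
      mul_mem' := fun {x y} _ hy => J.mul_mem_left' x hy
      star_mem' := fun {x} hx => J.star_mem hx }
  have hB : IsClosed (B : Set A) := J.isClosed'
  let _ : NonUnitalCStarAlgebra B :=
    NonUnitalStarSubalgebra.nonUnitalCStarAlgebra B (h_closed := hB)
  let _ : PartialOrder B := CStarAlgebra.spectralOrder B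
  have : StarOrderedRing B := CStarAlgebra.spectralOrderedRing B
  let _ : PartialOrder (Unitization ℂ A) := CStarAlgebra.spectralOrder _
  have : StarOrderedRing (Unitization ℂ A) := CStarAlgebra.spectralOrderedRing _
  have hl := CStarAlgebra.increasingApproximateUnit B
  have := hl.neBot
  let b : B := ⟨j, hj⟩
  have h1 : Filter.Tendsto (fun w : B => ‖b - b * w‖) (CStarAlgebra.approximateUnit B)
      (nhds 0) := by
    have h5 : Filter.Tendsto (fun w : B => b - b * w)
        (CStarAlgebra.approximateUnit B) (nhds (b - b)) :=
      tendsto_const_nhds.sub (hl.tendsto_mul_left b)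
    simpa using h5.norm
  obtain ⟨w, hw1, hw2, hw3, hw4⟩ := ((h1.eventually (ge_mem_nhds hε)).and
    (hl.eventually_norm.and (hl.eventually_star_eq.and hl.eventually_nonneg))).exists
  refine ⟨w, w.2, congrArg Subtype.val hw3, ?_, hw1⟩
  let ι : B →⋆ₙₐ[ℂ] Unitization ℂ A :=
    (Unitization.inrNonUnitalStarAlgHom ℂ A).comp (NonUnitalStarSubalgebraClass.subtype B)
  have hpos : (0 : Unitization ℂ A) ≤ ι w := map_nonneg ι hw4
  have hnorm : ‖ι w‖ ≤ 1 := (NonUnitalStarAlgHom.norm_apply_le ι w).trans hw2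
  have hle : ι w ≤ 1 := (CStarAlgebra.norm_le_one_iff_of_nonneg _ hpos).1 hnorm
  -- In the unitization `0 ≤ w ≤ 1`, hence `0 ≤ 1 - w ≤ 1`.
  exact (CStarAlgebra.norm_le_one_iff_of_nonneg _ (sub_nonneg.2 hle)).2
    (sub_le_self _ hpos)

/-- The quotient norm. -/
noncomputable abbrev quotientNormedAddCommGroup {A : Type u} [NonUnitalCStarAlgebra A]
    (J : ClosedIdeal A) : NormedAddCommGroup J.Quotient :=
  haveI : IsClosed (J.toSubmodule : Set A) := J.isClosed'
  Submodule.Quotient.normedAddCommGroup J.toSubmodule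

theorem exists_norm_lt {A : Type u} [NonUnitalCStarAlgebra A] (J : ClosedIdeal A)
    (x : J.Quotient) {ε : ℝ} (hε : 0 < ε) :
    letI := J.quotientNormedAddCommGroup
    ∃ a, J.toQuot a = x ∧ ‖a‖ < ‖x‖ + ε :=
  Submodule.Quotient.norm_mk_lt (S := J.toSubmodule) x hε

theorem norm_toQuot_le {A : Type u} [NonUnitalCStarAlgebra A] (J : ClosedIdeal A) (a : A) :
    letI := J.quotientNormedAddCommGroup
    ‖J.toQuot a‖ ≤ ‖a‖ :=
  Submodule.Quotient.norm_mk_le (S := J.toSubmodule) a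

/-- The `C*`-inequality for the quotient norm. With `u = 1 - w` for an approximate unit `w` of `J`,
the element `a u` represents the class of `a`, and `‖a u‖² = ‖u a* a u‖`. Replacing `a* a` by a
nearly optimal representative `c` of its class costs `u j u` with `j = a* a - c ∈ J`, which is small
by the choice of `w`. -/
theorem norm_toQuot_mul_self_le {A : Type u} [NonUnitalCStarAlgebra A] (J : ClosedIdeal A)
    (a : A) :
    letI := J.quotientNormedAddCommGroup
    ‖J.toQuot a‖ * ‖J.toQuot a‖ ≤ ‖J.toQuot (star a * a)‖ := by
  let _ := J.quotientNormedAddCommGroup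
  refine le_of_forall_pos_le_add fun ε hε => ?_
  obtain ⟨c, hc, hcn⟩ := J.exists_norm_lt (J.toQuot (star a * a)) (half_pos hε)
  have hj := J.toQuot_eq.1 hc.symm
  obtain ⟨w, hwJ, hws, hw1, hw2⟩ := J.exists_local_unit hj (half_pos hε)
  have ha : J.toQuot (a - a * w) = J.toQuot a := by
    refine J.toQuot_eq.2 ?_
    have : a - a * w - a = -(a * w) := by abel
    rw [this]
    exact neg_mem (J.mul_mem_left' a hwJ)
  have hna : ‖J.toQuot a‖ ≤ ‖a - a * w‖ := ha ▸ J.norm_toQuot_le (a - a * w)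
  set u : Unitization ℂ A := 1 - (w : Unitization ℂ A) with hu
  have hus : star u = u := by rw [hu, star_sub, star_one, ← Unitization.inr_star, hws]
  have key : ‖a - a * w‖ * ‖a - a * w‖ ≤ ‖c‖ + ε / 2 := by
    rw [← CStarRing.norm_star_mul_self, ← Unitization.norm_inr (𝕜 := ℂ)]
    have e : ((star (a - a * w) * (a - a * w) : A) : Unitization ℂ A) =
        u * (c : Unitization ℂ A) * u + u * ((star a * a - c) -
          (star a * a - c) * w : A) := by
      have e1 : (star (a - a * w) * (a - a * w)) =
        star a * a - star a * a * w - w * (star a * a) + w * (star a * a) * w := by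
        rw [star_sub, star_mul, hws]; noncomm_ring
      rw [e1, hu]
      push_cast
      noncomm_ring
    rw [e]
    refine (norm_add_le _ _).trans (add_le_add ?_ ?_)
    · calc ‖u * (c : Unitization ℂ A) * u‖ ≤ ‖u‖ * ‖(c : Unitization ℂ A)‖ * ‖u‖ :=
            norm_mul₃_le
        _ ≤ 1 * ‖(c : Unitization ℂ A)‖ * 1 := by gcongr
        _ = ‖c‖ := by rw [Unitization.norm_inr]; ring
    · refine (norm_mul_le _ _).trans ?_
      rw [Unitization.norm_inr]
      calc _ ≤ 1 * (ε / 2) := by gcongr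
        _ = ε / 2 := one_mul _
  calc ‖J.toQuot a‖ * ‖J.toQuot a‖ ≤ ‖a - a * w‖ * ‖a - a * w‖ := by gcongr
    _ ≤ ‖c‖ + ε / 2 := key
    _ ≤ _ := by linarith

/-- The quotient of a `C*`-algebra by a closed ideal is a `C*`-algebra in the quotient norm. -/
noncomputable abbrev quotientCStarAlgebra {A : Type u} [NonUnitalCStarAlgebra A]
    (J : ClosedIdeal A) : NonUnitalCStarAlgebra J.Quotient :=
  { J.quotientNormedAddCommGroup with
    left_distrib := fun x y z => by
      obtain ⟨x, rfl⟩ := J.toQuot_surjective x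
      obtain ⟨y, rfl⟩ := J.toQuot_surjective y
      obtain ⟨z, rfl⟩ := J.toQuot_surjective z
      exact congrArg J.toQuot (mul_add x y z)
    right_distrib := fun x y z => by
      obtain ⟨x, rfl⟩ := J.toQuot_surjective x
      obtain ⟨y, rfl⟩ := J.toQuot_surjective y
      obtain ⟨z, rfl⟩ := J.toQuot_surjective z
      exact congrArg J.toQuot (add_mul x y z)
    zero_mul := fun x => by
      obtain ⟨x, rfl⟩ := J.toQuot_surjective x
      have := J.toQuot_mul 0 x
      rw [zero_mul, map_zero] at this
      exact this.symm
    mul_zero := fun x => by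
      obtain ⟨x, rfl⟩ := J.toQuot_surjective x
      have := J.toQuot_mul x 0
      rw [mul_zero, map_zero] at this
      exact this.symm
    mul_assoc := fun x y z => by
      obtain ⟨x, rfl⟩ := J.toQuot_surjective x
      obtain ⟨y, rfl⟩ := J.toQuot_surjective y
      obtain ⟨z, rfl⟩ := J.toQuot_surjective z
      simp only [← J.toQuot_mul, mul_assoc]
    norm_mul_le := fun x y => by
      let _ := J.quotientNormedAddCommGroup
      change ‖x * y‖ ≤ ‖x‖ * ‖y‖
      -- Representatives of norm below `‖x‖ + ε` and `‖y‖ + ε` bound the product; then `ε` tends to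
      -- `0` from above.
      refine le_of_tendsto_of_tendsto (b := nhdsWithin (0 : ℝ) (Set.Ioi 0))
        (f := fun _ => ‖x * y‖) (g := fun ε => (‖x‖ + ε) * (‖y‖ + ε)) tendsto_const_nhds ?_ ?_
      · have : Continuous fun ε : ℝ => (‖x‖ + ε) * (‖y‖ + ε) := by fun_prop
        have h := this.tendsto 0
        simp only [add_zero] at h
        exact h.mono_left nhdsWithin_le_nhds
      · filter_upwards [self_mem_nhdsWithin] with ε hε
        obtain ⟨a, rfl, ha⟩ := J.exists_norm_lt x hε
        obtain ⟨b, rfl, hb⟩ := J.exists_norm_lt y hε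
        rw [← J.toQuot_mul]
        refine (J.norm_toQuot_le _).trans ((norm_mul_le a b).trans ?_)
        exact mul_le_mul ha.le hb.le (norm_nonneg _) ((norm_nonneg _).trans ha.le)
    star_involutive := fun x => by
      obtain ⟨x, rfl⟩ := J.toQuot_surjective x
      simp only [← J.toQuot_star, star_star]
    star_mul := fun x y => by
      obtain ⟨x, rfl⟩ := J.toQuot_surjective x
      obtain ⟨y, rfl⟩ := J.toQuot_surjective y
      simp only [← J.toQuot_star, ← J.toQuot_mul, star_mul]
    star_add := fun x y => by
      obtain ⟨x, rfl⟩ := J.toQuot_surjective x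
      obtain ⟨y, rfl⟩ := J.toQuot_surjective y
      exact congrArg J.toQuot (star_add x y)
    norm_mul_self_le := fun x => by
      obtain ⟨x, rfl⟩ := J.toQuot_surjective x
      rw [← J.toQuot_star, ← J.toQuot_mul]
      exact J.norm_toQuot_mul_self_le x
    complete := fun hf => by
      have : IsClosed (J.toSubmodule : Set A) := J.isClosed'
      exact (Submodule.Quotient.completeSpace J.toSubmodule).complete hf
    smul_zero := fun c => smul_zero (A := A ⧸ J.toSubmodule) c
    smul_add := fun c => smul_add (A := A ⧸ J.toSubmodule) c
    zero_smul := fun x => zero_smul ℂ (show A ⧸ J.toSubmodule from x)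
    add_smul := fun c d x => add_smul c d (show A ⧸ J.toSubmodule from x)
    norm_smul_le := fun c x => by
      have : IsClosed (J.toSubmodule : Set A) := J.isClosed'
      exact (Submodule.Quotient.normedSpace J.toSubmodule ℂ).norm_smul_le c x
    smul_assoc := fun c x y => by
      obtain ⟨x, rfl⟩ := J.toQuot_surjective x
      obtain ⟨y, rfl⟩ := J.toQuot_surjective y
      change (c • J.toQuot x) * J.toQuot y = c • (J.toQuot x * J.toQuot y)
      simp only [← J.toQuot_mul, ← map_smul, smul_mul_assoc]
    smul_comm := fun c x y => by
      obtain ⟨x, rfl⟩ := J.toQuot_surjective x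
      obtain ⟨y, rfl⟩ := J.toQuot_surjective y
      change c • (J.toQuot x * J.toQuot y) = J.toQuot x * (c • J.toQuot y)
      simp only [← J.toQuot_mul, ← map_smul, mul_smul_comm]
    star_smul := fun c x => by
      obtain ⟨x, rfl⟩ := J.toQuot_surjective x
      simp only [← J.toQuot_star, ← map_smul, star_smul] }

/-- The quotient map as a `*`-homomorphism. -/
noncomputable def quotientHom {A : Type u} [NonUnitalCStarAlgebra A] (J : ClosedIdeal A) :
    letI := J.quotientCStarAlgebra
    A →⋆ₙₐ[ℂ] J.Quotient :=
  letI := J.quotientCStarAlgebra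
  { toFun := J.toQuot
    map_smul' := J.toQuot.map_smul
    map_zero' := J.toQuot.map_zero
    map_add' := J.toQuot.map_add
    map_mul' := J.toQuot_mul
    map_star' := J.toQuot_star }

end ClosedIdeal

/-! ### Paths and the monomials `S_μ S_ν*`. -/

namespace RowFiniteGraph

/-- The range of the path with edges `l` that starts at `x`. -/
def pathRange {V : Type u} {Ed : Type v} (E : RowFiniteGraph V Ed) : List Ed → V → V
  | [], x => x
  | e :: _, _ => E.r e

/-- `l` is the list of edges of a path with source `x`. -/
def IsPath {V : Type u} {Ed : Type v} (E : RowFiniteGraph V Ed) : List Ed → V → Prop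
  | [], _ => True
  | e :: l, x => E.s e = E.pathRange l x ∧ E.IsPath l x

/-- The product `S e₁ ⋯ S eₙ P x`. -/
def pathElt {V : Type u} {Ed : Type v} {A : Type w} [Mul A] (P : V → A) (S : Ed → A) :
    List Ed → V → A
  | [], x => P x
  | e :: l, x => S e * pathElt P S l x

/-- The span of the elements `S_μ S_ν*` for paths `μ`, `ν` of equal length. -/
def coreSpan {V : Type u} {Ed : Type v} {A : Type w} [NonUnitalCStarAlgebra A]
    (P : V → A) (S : Ed → A) : Submodule ℂ A :=
  Submodule.span ℂ {a | ∃ l x l' x', l.length = l'.length ∧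
    a = pathElt P S l x * star (pathElt P S l' x')}

namespace IsCKFamily

variable {V : Type u} {Ed : Type v} {E : RowFiniteGraph V Ed} {A : Type w}
  [NonUnitalCStarAlgebra A] {P : V → A} {S : Ed → A}

/-- A consequence of `S* S = P` alone: with `T = S P - S`, expanding shows `T* T = 0`, and the
`C*`-identity applies. -/
theorem s_mul_p (h : E.IsCKFamily P S) (e : Ed) : S e * P (E.s e) = S e := by
  rw [← sub_eq_zero, ← CStarRing.star_mul_self_eq_zero_iff]
  have h1 := h.star_s_mul_s e
  have h2 := h.p_mul_self (E.s e)
  have e1 : star (S e * P (E.s e) - S e) * (S e * P (E.s e) - S e) =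
      P (E.s e) * (star (S e) * S e) * P (E.s e) - P (E.s e) * (star (S e) * S e)
        - (star (S e) * S e) * P (E.s e) + star (S e) * S e := by
    rw [star_sub, star_mul, h.star_p]
    noncomm_ring
  rw [e1, h1, h2, h2]
  abel

theorem star_s_mul_p (h : E.IsCKFamily P S) (e : Ed) : star (S e) * P (E.r e) = star (S e) := by
  rw [← h.star_p, ← star_mul, h.p_mul_s]

/-- If the ranges agree, compress `∑ S_g S_g* = P` by `S_f`: the term of `f` already gives all of `P
(s f)`, so the remaining terms `(S_g* S_f)* (S_g* S_f)` are positive with sum zero and each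
vanishes. If the ranges differ, the two range projections are orthogonal. -/
theorem star_s_mul_s_of_ne (h : E.IsCKFamily P S) {e f : Ed} (hef : e ≠ f) :
    star (S e) * S f = 0 := by
  classical
  by_cases hr : E.r e = E.r f
  · let _ : PartialOrder A := CStarAlgebra.spectralOrder A
    have : StarOrderedRing A := CStarAlgebra.spectralOrderedRing A
    have hsum := h.sum_s (E.r f) ⟨f, rfl⟩
    have hf : f ∈ (E.finite_fiber (E.r f)).toFinset := by simp
    have he : e ∈ (E.finite_fiber (E.r f)).toFinset.erase f := by simp [hr, hef]
    have h1 : star (S f) * (∑ g ∈ (E.finite_fiber (E.r f)).toFinset, S g * star (S g)) * S f =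
        P (E.s f) := by
      rw [hsum, mul_assoc, h.p_mul_s, h.star_s_mul_s]
    rw [← Finset.add_sum_erase _ _ hf, mul_add, add_mul] at h1
    have h2 : star (S f) * (S f * star (S f)) * S f = P (E.s f) := by
      rw [← mul_assoc, h.star_s_mul_s, mul_assoc, h.star_s_mul_s, h.p_mul_self]
    rw [h2, add_eq_left, Finset.mul_sum, Finset.sum_mul] at h1
    have h3 : ∀ g ∈ (E.finite_fiber (E.r f)).toFinset.erase f,
        0 ≤ star (S f) * (S g * star (S g)) * S f := fun g _ => by
      have : star (S f) * (S g * star (S g)) * S f =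
        star (star (S g) * S f) * (star (S g) * S f) := by
        rw [star_mul, star_star]; noncomm_ring
      rw [this]
      exact star_mul_self_nonneg _
    have h4 := (Finset.sum_eq_zero_iff_of_nonneg h3).1 h1 e he
    rw [← CStarRing.star_mul_self_eq_zero_iff, ← h4, star_mul, star_star]
    noncomm_ring
  · rw [← h.star_s_mul_p e, ← h.p_mul_s f, mul_assoc, ← mul_assoc (P (E.r e)),
      h.p_mul_p _ _ hr, zero_mul, mul_zero]

theorem p_mul_pathElt (h : E.IsCKFamily P S) (l : List Ed) (x : V) :
    P (E.pathRange l x) * pathElt P S l x = pathElt P S l x := by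
  cases l with
  | nil => exact h.p_mul_self x
  | cons e l => rw [pathElt, pathRange, ← mul_assoc, h.p_mul_s]

theorem p_mul_pathElt_of_ne (h : E.IsCKFamily P S) (l : List Ed) (x : V) {y : V}
    (hy : y ≠ E.pathRange l x) : P y * pathElt P S l x = 0 := by
  rw [← h.p_mul_pathElt, ← mul_assoc, h.p_mul_p _ _ hy, zero_mul]

theorem pathElt_mul_p (h : E.IsCKFamily P S) (l : List Ed) (x : V) :
    pathElt P S l x * P x = pathElt P S l x := by
  induction l with
  | nil => exact h.p_mul_self x
  | cons e l ih => rw [pathElt, mul_assoc, ih]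

theorem p_mul_star_pathElt (h : E.IsCKFamily P S) (l : List Ed) (x : V) :
    P x * star (pathElt P S l x) = star (pathElt P S l x) := by
  rw [← h.star_p x, ← star_mul, h.pathElt_mul_p]

theorem star_pathElt_mul_p (h : E.IsCKFamily P S) (l : List Ed) (x : V) :
    star (pathElt P S l x) * P (E.pathRange l x) = star (pathElt P S l x) := by
  rw [← h.star_p (E.pathRange l x), ← star_mul, h.p_mul_pathElt]

/-- Allows spans to be indexed by arbitrary lists of edges and arbitrary vertices: the lists that
are not paths contribute nothing. -/
theorem pathElt_of_not_isPath (h : E.IsCKFamily P S) {l : List Ed} {x : V}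
    (hl : ¬ E.IsPath l x) : pathElt P S l x = 0 := by
  induction l with
  | nil => exact absurd trivial hl
  | cons e l ih =>
    by_cases hp : E.IsPath l x
    · have hne : E.s e ≠ E.pathRange l x := fun h' => hl ⟨h', hp⟩
      rw [pathElt, ← h.s_mul_p, mul_assoc, h.p_mul_pathElt_of_ne l x hne, mul_zero]
    · rw [pathElt, ih hp, mul_zero]

theorem star_pathElt_mul_self (h : E.IsCKFamily P S) {l : List Ed} {x : V}
    (hl : E.IsPath l x) : star (pathElt P S l x) * pathElt P S l x = P x := by
  induction l with
  | nil => rw [pathElt, h.star_p, h.p_mul_self]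
  | cons e l ih =>
    rw [pathElt, star_mul, mul_assoc, ← mul_assoc (star (S e)), h.star_s_mul_s, hl.1,
      h.p_mul_pathElt, ih hl.2]

/-- The product of an adjoint path with a path. -/
theorem star_pathElt_mul_pathElt (h : E.IsCKFamily P S) (l : List Ed) (x : V) (l' : List Ed)
    (x' : V) : star (pathElt P S l x) * pathElt P S l' x' = 0 ∨
      (∃ m, l' = l ++ m ∧ star (pathElt P S l x) * pathElt P S l' x' = pathElt P S m x') ∨
      (∃ m, l = l' ++ m ∧ star (pathElt P S l x) * pathElt P S l' x' =
        star (pathElt P S m x)) := by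
  induction l generalizing l' with
  | nil =>
    by_cases hx : x = E.pathRange l' x'
    · refine Or.inr (Or.inl ⟨l', rfl, ?_⟩)
      rw [pathElt, h.star_p, hx, h.p_mul_pathElt]
    · exact Or.inl (by rw [pathElt, h.star_p, h.p_mul_pathElt_of_ne _ _ hx])
  | cons e l ih =>
    cases l' with
    | nil =>
      by_cases hx : x' = E.pathRange (e :: l) x
      · refine Or.inr (Or.inr ⟨e :: l, rfl, ?_⟩)
        rw [pathElt.eq_1 P S x', hx, h.star_pathElt_mul_p]
      · refine Or.inl ?_
        rw [pathElt.eq_1 P S x', ← h.star_p, ← star_mul, h.p_mul_pathElt_of_ne _ _ hx, star_zero]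
    | cons f l' =>
      by_cases hef : e = f
      · subst hef
        have e1 : star (pathElt P S (e :: l) x) * pathElt P S (e :: l') x' =
            star (pathElt P S l x) * (P (E.s e) * pathElt P S l' x') := by
          rw [pathElt, pathElt, star_mul, mul_assoc, ← mul_assoc (star (S e)), h.star_s_mul_s]
        by_cases hx : E.s e = E.pathRange l' x'
        · rw [hx, h.p_mul_pathElt] at e1
          rw [e1]
          rcases ih l' with h0 | ⟨m, hm, h0⟩ | ⟨m, hm, h0⟩
          · exact Or.inl h0
          · exact Or.inr (Or.inl ⟨m, by rw [hm]; rfl, h0⟩)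
          · exact Or.inr (Or.inr ⟨m, by rw [hm]; rfl, h0⟩)
        · rw [h.p_mul_pathElt_of_ne _ _ hx, mul_zero] at e1
          exact Or.inl e1
      · refine Or.inl ?_
        rw [pathElt, pathElt, star_mul, mul_assoc, ← mul_assoc (star (S e)),
          h.star_s_mul_s_of_ne hef, zero_mul, mul_zero]

theorem pathElt_mul_s (h : E.IsCKFamily P S) (l : List Ed) (e : Ed) :
    pathElt P S l (E.r e) * S e = pathElt P S (l ++ [e]) (E.s e) := by
  induction l with
  | nil => rw [pathElt, h.p_mul_s, List.nil_append, pathElt, pathElt, h.s_mul_p]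
  | cons f l ih => rw [pathElt, mul_assoc, ih]; rfl

theorem pathElt_mul_pathElt (h : E.IsCKFamily P S) (l : List Ed) (x : V) (l' : List Ed) (x' : V) :
    pathElt P S l x * pathElt P S l' x' = 0 ∨
      pathElt P S l x * pathElt P S l' x' = pathElt P S (l ++ l') x' := by
  induction l with
  | nil =>
    by_cases hx : x = E.pathRange l' x'
    · right; rw [pathElt, hx, h.p_mul_pathElt]; rfl
    · left; rw [pathElt, h.p_mul_pathElt_of_ne _ _ hx]
  | cons e l ih =>
    rcases ih with h0 | h0
    · left; rw [pathElt, mul_assoc, h0, mul_zero]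
    · right; rw [pathElt, mul_assoc, h0]; rfl

/-- The elements `S_μ S_ν*` (together with zero) are closed under multiplication. -/
theorem monomial_mul_monomial (h : E.IsCKFamily P S) (l₁ l₂ l₃ l₄ : List Ed) (x₁ x₂ x₃ x₄ : V) :
    pathElt P S l₁ x₁ * star (pathElt P S l₂ x₂) *
        (pathElt P S l₃ x₃ * star (pathElt P S l₄ x₄)) ∈
      Submodule.span ℂ {a | ∃ l x l' x', a = pathElt P S l x * star (pathElt P S l' x')} := by
  have e1 : pathElt P S l₁ x₁ * star (pathElt P S l₂ x₂) *
        (pathElt P S l₃ x₃ * star (pathElt P S l₄ x₄)) =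
      pathElt P S l₁ x₁ * (star (pathElt P S l₂ x₂) * pathElt P S l₃ x₃) *
        star (pathElt P S l₄ x₄) := by noncomm_ring
  rw [e1]
  rcases h.star_pathElt_mul_pathElt l₂ x₂ l₃ x₃ with h0 | ⟨m, -, h0⟩ | ⟨m, -, h0⟩ <;> rw [h0]
  · simp
  · rcases h.pathElt_mul_pathElt l₁ x₁ m x₃ with h1 | h1 <;> rw [h1]
    · simp
    · exact Submodule.subset_span ⟨_, _, _, _, rfl⟩
  · rw [mul_assoc, ← star_mul]
    rcases h.pathElt_mul_pathElt l₄ x₄ m x₂ with h1 | h1 <;> rw [h1]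
    · simp
    · exact Submodule.subset_span ⟨_, _, _, _, rfl⟩

end IsCKFamily

/-- The elements `s_μ s_ν*` span a dense subspace of `C*(E)`. -/
theorem dense_span_monomials {V : Type u} {Ed : Type v} (E : RowFiniteGraph V Ed) :
    Dense (Submodule.span ℂ {a | ∃ l x l' x',
      a = pathElt E.p E.se l x * star (pathElt E.p E.se l' x')} : Set E.CStarAlg) := by
  have h := E.isCKFamily
  set M := Submodule.span ℂ {a | ∃ l x l' x',
      a = pathElt E.p E.se l x * star (pathElt E.p E.se l' x')} with hM
  have hmul : ∀ a ∈ M, ∀ b ∈ M, a * b ∈ M := fun a ha b hb => by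
    induction ha using Submodule.span_induction with
    | zero => simp
    | add a a' _ _ h1 h2 => rw [add_mul]; exact add_mem h1 h2
    | smul c a _ h1 => rw [smul_mul_assoc]; exact M.smul_mem c h1
    | mem a ha =>
      obtain ⟨l₁, x₁, l₂, x₂, rfl⟩ := ha
      induction hb using Submodule.span_induction with
      | zero => simp
      | add a a' _ _ h1 h2 => rw [mul_add]; exact add_mem h1 h2
      | smul c a _ h1 => rw [mul_smul_comm]; exact M.smul_mem c h1
      | mem b hb =>
        obtain ⟨l₃, x₃, l₄, x₄, rfl⟩ := hb
        exact h.monomial_mul_monomial _ _ _ _ _ _ _ _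
  have hstar : ∀ a ∈ M, star a ∈ M := fun a ha => by
    induction ha using Submodule.span_induction with
    | zero => simp
    | add a a' _ _ h1 h2 => rw [star_add]; exact add_mem h1 h2
    | smul c a _ h1 => rw [star_smul]; exact M.smul_mem _ h1
    | mem a ha =>
      obtain ⟨l₁, x₁, l₂, x₂, rfl⟩ := ha
      rw [star_mul, star_star]
      exact Submodule.subset_span ⟨_, _, _, _, rfl⟩
  -- `M` is a `*`-subalgebra containing the generators, since `p = p p*` and `s_e = (s_e p) p*`; so
  -- its image contains everything that they generate algebraically.
  have key : ∀ a ∈ NonUnitalStarAlgebra.adjoin ℂ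
      (Set.range (UnitalAlg.p E) ∪ Set.range (UnitalAlg.s E)), ∃ b ∈ M, E.incl b = a := by
    intro a ha
    induction ha using NonUnitalStarAlgebra.adjoin_induction with
    | mem x hx =>
      rcases hx with ⟨x, rfl⟩ | ⟨e, rfl⟩
      · refine ⟨E.p x, Submodule.subset_span ⟨[], x, [], x, ?_⟩, rfl⟩
        rw [pathElt, h.star_p, h.p_mul_self]
      · refine ⟨E.se e, Submodule.subset_span ⟨[e], E.s e, [], E.s e, ?_⟩, rfl⟩
        rw [pathElt, pathElt, pathElt, h.star_p, mul_assoc, h.p_mul_self, h.s_mul_p]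
    | add x y hx hy h1 h2 =>
      obtain ⟨b, hb, rfl⟩ := h1
      obtain ⟨c, hc, rfl⟩ := h2
      exact ⟨b + c, add_mem hb hc, map_add _ _ _⟩
    | zero => exact ⟨0, zero_mem _, map_zero _⟩
    | mul x y hx hy h1 h2 =>
      obtain ⟨b, hb, rfl⟩ := h1
      obtain ⟨c, hc, rfl⟩ := h2
      exact ⟨b * c, hmul _ hb _ hc, map_mul _ _ _⟩
    | smul c x hx h1 =>
      obtain ⟨b, hb, rfl⟩ := h1
      exact ⟨c • b, M.smul_mem c hb, map_smul _ _ _⟩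
    | star x hx h1 =>
      obtain ⟨b, hb, rfl⟩ := h1
      exact ⟨star b, hstar b hb, map_star _ _⟩
  intro a
  rw [E.isometry_incl.isUniformInducing.isInducing.closure_eq_preimage_closure_image]
  exact closure_mono (fun b hb => key b hb) (E.incl_mem_closure a)

end RowFiniteGraph

/-! ### Averaging over the gauge action. -/

section Expectation

open MeasureTheory AddCircle

/-- If a continuous nonnegative function with values in a `C*`-algebra has zero integral
then it vanishes. -/
theorem eq_zero_of_integral_eq_zero_of_nonneg {A : Type u} [NonUnitalCStarAlgebra A]
    [PartialOrder A] [StarOrderedRing A] {X : Type v} [TopologicalSpace X] [CompactSpace X]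
    [MeasurableSpace X] [BorelSpace X] {μ : Measure X} [IsFiniteMeasure μ] [μ.IsOpenPosMeasure]
    {f : X → A} (hf : Continuous f) (h0 : ∀ t, 0 ≤ f t) (hint : Integrable f μ)
    (h : ∫ t, f t ∂μ = 0) (x : X) : f x = 0 := by
  rw [← norm_le_zero_iff]
  refine le_of_forall_pos_le_add fun ε hε => ?_
  rw [zero_add]
  set U : Set X := {t | ‖f t - f x‖ < ε} with hU
  have hUo : IsOpen U := isOpen_lt (by fun_prop) continuous_const
  have hxU : x ∈ U := by simp [hU, hε]
  have hpos : 0 < μ.real U :=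
    ENNReal.toReal_pos (hUo.measure_ne_zero μ ⟨x, hxU⟩) (measure_ne_top μ U)
  have hsplit := integral_add_compl hUo.measurableSet hint
  rw [h] at hsplit
  -- In the operator order the integral over `U` lies between `0` and the total integral. As `f`
  -- stays within `ε` of `f x` on `U`, this bounds `μ(U) ‖f x‖` by `ε μ(U)`.
  have hU0 : ∫ t in U, f t ∂μ = 0 := by
    refine le_antisymm ?_ (integral_nonneg h0)
    rw [← hsplit]
    exact le_add_of_nonneg_right (integral_nonneg h0)
  have h1 : ∫ t in U, (f t - f x) ∂μ = - (μ.real U • f x) := by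
    rw [integral_sub hint.integrableOn (integrable_const _), hU0, zero_sub, setIntegral_const]
  have h2 : ‖∫ t in U, (f t - f x) ∂μ‖ ≤ ε * μ.real U :=
    norm_setIntegral_le_of_norm_le_const (measure_lt_top μ U) fun t ht => (le_of_lt ht)
  rw [h1, norm_neg, norm_smul, Real.norm_of_nonneg hpos.le, mul_comm] at h2
  exact le_of_mul_le_mul_right h2 hpos

namespace RowFiniteGraph

theorem gauge_pathElt {V : Type u} {Ed : Type v} (E : RowFiniteGraph V Ed) (z : Circle)
    (l : List Ed) (x : V) :
    E.gauge z (pathElt E.p E.se l x) = (z ^ l.length : ℂ) • pathElt E.p E.se l x := by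
  induction l with
  | nil => simp [pathElt, gauge_p]
  | cons e l ih =>
    rw [pathElt, map_mul, ih, gauge_se, smul_mul_smul_comm, List.length_cons, pow_succ']

theorem gauge_monomial {V : Type u} {Ed : Type v} (E : RowFiniteGraph V Ed) (z : Circle)
    (l l' : List Ed) (x x' : V) :
    E.gauge z (pathElt E.p E.se l x * star (pathElt E.p E.se l' x')) =
      ((z ^ ((l.length : ℤ) - l'.length) : Circle) : ℂ) •
        (pathElt E.p E.se l x * star (pathElt E.p E.se l' x')) := by
  rw [map_mul, map_star, gauge_pathElt, gauge_pathElt, star_smul, smul_mul_smul_comm]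
  congr 1
  rw [zpow_sub, Circle.coe_mul, Circle.coe_inv_eq_conj, zpow_natCast, zpow_natCast]
  simp

theorem norm_gauge_le {V : Type u} {Ed : Type v} (E : RowFiniteGraph V Ed) (z : Circle)
    (a : E.CStarAlg) : ‖E.gauge z a‖ ≤ ‖a‖ :=
  NonUnitalStarAlgHom.norm_apply_le (E.gauge z) a

theorem gauge_one {V : Type u} {Ed : Type v} (E : RowFiniteGraph V Ed) (a : E.CStarAlg) :
    E.gauge 1 a = a := by
  have : E.gauge 1 = NonUnitalStarAlgHom.id ℂ E.CStarAlg :=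
    hom_ext (fun x => E.gauge_p 1 x) (fun e => by rw [gauge_se]; simp)
  rw [this]; rfl

/-- Makes each `γ_z` surjective, which carries gauge invariance from an ideal to its annihilator. -/
theorem gauge_gauge_inv {V : Type u} {Ed : Type v} (E : RowFiniteGraph V Ed) (z : Circle)
    (a : E.CStarAlg) : E.gauge z (E.gauge z⁻¹ a) = a := by
  have : (E.gauge z).comp (E.gauge z⁻¹) = NonUnitalStarAlgHom.id ℂ E.CStarAlg := by
    refine hom_ext (fun x => ?_) (fun e => ?_)
    · simp [gauge_p]
    · simp only [NonUnitalStarAlgHom.comp_apply, gauge_se, map_smul, smul_smul,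
        ← Circle.coe_mul, inv_mul_cancel, Circle.coe_one, one_smul, NonUnitalStarAlgHom.coe_id,
        id_eq]
  exact DFunLike.congr_fun this a

/-- Each `γ_z` is contractive, so the elements with continuous orbit form a closed set. A monomial
`s_μ s_ν*` is an eigenvector with eigenvalue `z ^ (|μ| - |ν|)`, and the monomials span a dense
subspace. -/
theorem continuous_gauge {V : Type u} {Ed : Type v} (E : RowFiniteGraph V Ed)
    (a : E.CStarAlg) : Continuous fun z => E.gauge z a := by
  have hclosed : IsClosed {a : E.CStarAlg | Continuous fun z => E.gauge z a} := by
    refine isClosed_of_closure_subset fun a ha => ?_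
    refine continuous_of_uniform_approx_of_continuous fun u hu => ?_
    obtain ⟨ε, hε, hu⟩ := Metric.mem_uniformity_dist.1 hu
    obtain ⟨b, hb, hab⟩ := Metric.mem_closure_iff.1 ha ε hε
    refine ⟨fun z => E.gauge z b, hb, fun z => hu ?_⟩
    rw [dist_eq_norm] at hab ⊢
    rw [← map_sub]
    exact (E.norm_gauge_le z _).trans_lt hab
  refine hclosed.closure_subset_iff.2 (fun b hb => ?_) (E.dense_span_monomials a)
  induction hb using Submodule.span_induction with
  | zero => simpa using continuous_const
  | add a a' _ _ h1 h2 =>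
    simp only [Set.mem_ofPred_eq, map_add] at h1 h2 ⊢
    exact h1.add h2
  | smul c a _ h1 =>
    simp only [Set.mem_ofPred_eq, map_smul] at h1 ⊢
    exact h1.const_smul c
  | mem a ha =>
    obtain ⟨l, x, l', x', rfl⟩ := ha
    simp only [Set.mem_ofPred_eq, gauge_monomial]
    exact ((continuous_subtype_val : Continuous ((↑) : Circle → ℂ)).comp
      (continuous_zpow (G := Circle) _)).smul continuous_const

theorem continuous_gauge_toCircle {V : Type u} {Ed : Type v} (E : RowFiniteGraph V Ed)
    (a : E.CStarAlg) : Continuous fun t : UnitAddCircle => E.gauge t.toCircle a :=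
  (E.continuous_gauge a).comp AddCircle.continuous_toCircle

theorem integrable_gauge {V : Type u} {Ed : Type v} (E : RowFiniteGraph V Ed)
    (a : E.CStarAlg) :
    Integrable (fun t : UnitAddCircle => E.gauge t.toCircle a) haarAddCircle :=
  (E.continuous_gauge_toCircle a).integrable_of_hasCompactSupport
    (HasCompactSupport.of_compactSpace _)

/-- The conditional expectation onto the fixed-point algebra of the gauge action. -/
noncomputable def expectation {V : Type u} {Ed : Type v} (E : RowFiniteGraph V Ed)
    (a : E.CStarAlg) : E.CStarAlg :=
  ∫ t : UnitAddCircle, E.gauge t.toCircle a ∂haarAddCircle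

theorem expectation_add {V : Type u} {Ed : Type v} (E : RowFiniteGraph V Ed)
    (a b : E.CStarAlg) : E.expectation (a + b) = E.expectation a + E.expectation b := by
  simp only [expectation, map_add]
  exact integral_add (E.integrable_gauge a) (E.integrable_gauge b)

theorem expectation_sub {V : Type u} {Ed : Type v} (E : RowFiniteGraph V Ed)
    (a b : E.CStarAlg) : E.expectation (a - b) = E.expectation a - E.expectation b := by
  simp only [expectation, map_sub]
  exact integral_sub (E.integrable_gauge a) (E.integrable_gauge b)

theorem expectation_smul {V : Type u} {Ed : Type v} (E : RowFiniteGraph V Ed)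
    (c : ℂ) (a : E.CStarAlg) : E.expectation (c • a) = c • E.expectation a := by
  simp only [expectation, map_smul]
  exact integral_smul c _

theorem norm_expectation_le {V : Type u} {Ed : Type v} (E : RowFiniteGraph V Ed)
    (a : E.CStarAlg) : ‖E.expectation a‖ ≤ ‖a‖ := by
  have h := norm_integral_le_of_norm_le_const (μ := (haarAddCircle : Measure UnitAddCircle))
    (f := fun t => E.gauge t.toCircle a) (C := ‖a‖)
    (Filter.Eventually.of_forall fun t => E.norm_gauge_le _ a)
  simpa [expectation] using h

/-- The expectation is an average against a probability measure, so it stays in a closed convex set.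
It is used for kernels of homomorphisms, for annihilators and for corners. -/
theorem expectation_mem {V : Type u} {Ed : Type v} (E : RowFiniteGraph V Ed)
    {K : Submodule ℂ E.CStarAlg} (hK : IsClosed (K : Set E.CStarAlg)) {a : E.CStarAlg}
    (ha : ∀ z, E.gauge z a ∈ K) : E.expectation a ∈ K :=
  (K.restrictScalars ℝ).convex.integral_mem hK
    (Filter.Eventually.of_forall fun _ => ha _) (E.integrable_gauge a)

/-- Faithfulness of the expectation: the orbit of `a* a` is a continuous positive function with zero
integral, hence vanishes at `t = 0`, where the gauge automorphism is the identity. -/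
theorem eq_zero_of_expectation_star_mul_self {V : Type u} {Ed : Type v}
    (E : RowFiniteGraph V Ed) {a : E.CStarAlg} (ha : E.expectation (star a * a) = 0) : a = 0 := by
  let _ : PartialOrder E.CStarAlg := CStarAlgebra.spectralOrder _
  have : StarOrderedRing E.CStarAlg := CStarAlgebra.spectralOrderedRing _
  have h := eq_zero_of_integral_eq_zero_of_nonneg (E.continuous_gauge_toCircle (star a * a))
    (fun t => by rw [map_mul, map_star]; exact star_mul_self_nonneg _)
    (E.integrable_gauge _) ha 0
  simpa [gauge_one, CStarRing.star_mul_self_eq_zero_iff] using h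

theorem expectation_monomial {V : Type u} {Ed : Type v} (E : RowFiniteGraph V Ed)
    (l l' : List Ed) (x x' : V) :
    E.expectation (pathElt E.p E.se l x * star (pathElt E.p E.se l' x')) =
      if l.length = l'.length then pathElt E.p E.se l x * star (pathElt E.p E.se l' x')
      else 0 := by
  simp only [expectation, gauge_monomial]
  split_ifs with h
  · simp [h]
  · rw [integral_smul_const]
    have hn : (l.length : ℤ) - l'.length ≠ 0 := by omega
    -- A suitable translation of the circle turns a nonconstant character into its negative, so its
    -- integral is zero.
    have h0 : ∫ t : UnitAddCircle, fourier ((l.length : ℤ) - l'.length) t ∂haarAddCircle = 0 :=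
      integral_eq_zero_of_add_right_eq_neg (fourier_add_half_inv_index hn one_pos)
    simp only [fourier_apply, toCircle_zsmul] at h0
    rw [h0, zero_smul]

/-- Values of the expectation are limits of elements of the core. -/
theorem expectation_mem_closure {V : Type u} {Ed : Type v} (E : RowFiniteGraph V Ed)
    (a : E.CStarAlg) {ε : ℝ} (hε : 0 < ε) :
    ∃ x ∈ coreSpan E.p E.se, ‖E.expectation a - x‖ < ε := by
  obtain ⟨y, hy, hay⟩ := Metric.mem_closure_iff.1 (E.dense_span_monomials a) ε hε
  refine ⟨E.expectation y, ?_, ?_⟩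
  · clear hay
    induction hy using Submodule.span_induction with
    | zero => simp [expectation]
    | add a a' _ _ h1 h2 => rw [expectation_add]; exact add_mem h1 h2
    | smul c a _ h1 => rw [expectation_smul]; exact Submodule.smul_mem _ c h1
    | mem a ha =>
      obtain ⟨l, x, l', x', rfl⟩ := ha
      rw [expectation_monomial]
      split_ifs with h
      · exact Submodule.subset_span ⟨l, x, l', x', h, rfl⟩
      · exact zero_mem _
  · rw [← expectation_sub]
    rw [dist_eq_norm] at hay
    exact (E.norm_expectation_le _).trans_lt hay

end RowFiniteGraph

end Expectation

/-! ### A representation on `ℓ²` in which no vertex projection vanishes. -/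

section Nondegenerate

open scoped InnerProductSpace ENNReal

namespace PEquiv

variable {I : Type u}

/-- The partial bijection `I ≃. I` that takes `f n` to `g n`, for injections `f` and `g`. -/
noncomputable def ofEmbeddings {K : Type v} (f g : K ↪ I) : I ≃. I where
  toFun i := by
    classical exact if h : ∃ k, f k = i then some (g h.choose) else none
  invFun i := by
    classical exact if h : ∃ k, g k = i then some (f h.choose) else none
  inv i j := by
    have hf : ∀ k (h : ∃ k', f k' = f k), h.choose = k := fun k h => f.injective h.choose_spec
    have hg : ∀ k (h : ∃ k', g k' = g k), h.choose = k := fun k h => g.injective h.choose_spec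
    constructor
    · intro h
      simp only [Option.dite_none_right_eq_some] at h ⊢
      obtain ⟨⟨k, rfl⟩, h⟩ := h
      rw [hg, Option.some_inj] at h
      subst h
      exact ⟨⟨k, rfl⟩, by rw [hf]⟩
    · intro h
      simp only [Option.dite_none_right_eq_some] at h ⊢
      obtain ⟨⟨k, rfl⟩, h⟩ := h
      rw [hf, Option.some_inj] at h
      subst h
      exact ⟨⟨k, rfl⟩, by rw [hg]⟩

theorem ofEmbeddings_apply {K : Type v} (f g : K ↪ I) (k : K) :
    ofEmbeddings f g (f k) = some (g k) := by
  classical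
  have h : ∃ k', f k' = f k := ⟨k, rfl⟩
  exact (dif_pos h).trans (congrArg (some ∘ g) (f.injective h.choose_spec))

theorem ofEmbeddings_of_notMem {K : Type v} (f g : K ↪ I) {i : I} (hi : ∀ k, f k ≠ i) :
    ofEmbeddings f g i = none :=
  dif_neg fun ⟨k, hk⟩ => hi k hk

theorem ofEmbeddings_symm {K : Type v} (f g : K ↪ I) :
    (ofEmbeddings f g).symm = ofEmbeddings g f := rfl

theorem ofEmbeddings_trans {K : Type v} (f g h : K ↪ I) :
    (ofEmbeddings f g).trans (ofEmbeddings g h) = ofEmbeddings f h := by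
  ext1 i
  change (ofEmbeddings f g i).bind (ofEmbeddings g h) = _
  by_cases hi : ∃ k, f k = i
  · obtain ⟨k, rfl⟩ := hi
    rw [ofEmbeddings_apply, ofEmbeddings_apply, Option.bind_some, ofEmbeddings_apply]
  · push Not at hi
    rw [ofEmbeddings_of_notMem _ _ hi, ofEmbeddings_of_notMem _ _ hi, Option.bind_none]

theorem ofEmbeddings_trans_eq_bot {K : Type v} {L : Type w} (f g : K ↪ I) (g' h : L ↪ I)
    (hg : ∀ k l, g k ≠ g' l) : (ofEmbeddings f g).trans (ofEmbeddings g' h) = ⊥ := by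
  ext1 i
  change (ofEmbeddings f g i).bind (ofEmbeddings g' h) = none
  by_cases hi : ∃ k, f k = i
  · obtain ⟨k, rfl⟩ := hi
    rw [ofEmbeddings_apply, Option.bind_some,
      ofEmbeddings_of_notMem _ _ fun l => (hg k l).symm]
  · push Not at hi
    rw [ofEmbeddings_of_notMem _ _ hi, Option.bind_none]

/-- A partial bijection never repeats a value, so the left side is a sum over distinct coordinates
of `x`. This gives both square-summability and contractivity of the operator of `σ`. -/
theorem sum_elim_le (σ : I ≃. I) (x : lp (fun _ : I => ℂ) 2) (s : Finset I) :
    ∑ i ∈ s, ‖(σ i).elim 0 x‖ ^ (2 : ℝ≥0∞).toReal ≤ ‖x‖ ^ (2 : ℝ≥0∞).toReal := by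
  classical
  have h2 : (0 : ℝ) < (2 : ℝ≥0∞).toReal := by norm_num
  rw [← Finset.sum_filter_add_sum_filter_not s (fun i => (σ i).isSome)]
  have h0 : ∑ i ∈ s with ¬ (σ i).isSome, ‖(σ i).elim 0 x‖ ^ (2 : ℝ≥0∞).toReal = 0 := by
    refine Finset.sum_eq_zero fun i hi => ?_
    have : σ i = none := by simpa using (Finset.mem_filter.1 hi).2
    simp [this]
  rw [h0, add_zero]
  calc _ = ∑ i ∈ s with (σ i).isSome, ‖x ((σ i).getD i)‖ ^ (2 : ℝ≥0∞).toReal := by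
        refine Finset.sum_congr rfl fun i hi => ?_
        obtain ⟨j, hj⟩ := Option.isSome_iff_exists.1 (Finset.mem_filter.1 hi).2
        simp [hj]
    _ = ∑ j ∈ (s.filter fun i => (σ i).isSome).image (fun i => (σ i).getD i),
          ‖x j‖ ^ (2 : ℝ≥0∞).toReal := by
        refine (Finset.sum_image (f := fun j => ‖x j‖ ^ (2 : ℝ≥0∞).toReal) ?_).symm
        intro i hi i' hi' h
        obtain ⟨j, hj⟩ := Option.isSome_iff_exists.1 (Finset.mem_filter.1 hi).2
        obtain ⟨j', hj'⟩ := Option.isSome_iff_exists.1 (Finset.mem_filter.1 hi').2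
        simp only [hj, hj', Option.getD_some] at h
        subst h
        exact σ.inj hj hj'
    _ ≤ _ := lp.sum_rpow_le_norm_rpow h2 x _

/-- The partial isometry of `ℓ²(I)` given by a partial bijection. -/
noncomputable def toCLM (σ : I ≃. I) :
    lp (fun _ : I => ℂ) 2 →L[ℂ] lp (fun _ : I => ℂ) 2 :=
  LinearMap.mkContinuous
    { toFun := fun x => ⟨fun i => (σ i).elim 0 x, memℓp_gen' (σ.sum_elim_le x)⟩
      map_add' := fun x y => by
        ext i
        change (σ i).elim 0 (x + y : lp (fun _ : I => ℂ) 2) = (σ i).elim 0 x + (σ i).elim 0 y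
        cases σ i
        · exact (add_zero 0).symm
        · rfl
      map_smul' := fun c x => by
        ext i
        change (σ i).elim 0 (c • x : lp (fun _ : I => ℂ) 2) = c • (σ i).elim 0 x
        cases σ i <;> simp }
    1 fun x => by
      rw [one_mul]
      exact lp.norm_le_of_forall_sum_le (by norm_num) (norm_nonneg _) (σ.sum_elim_le x)

theorem toCLM_apply (σ : I ≃. I) (x : lp (fun _ : I => ℂ) 2) (i : I) :
    toCLM σ x i = (σ i).elim 0 x := rfl

/-- The operator of `σ` pulls coordinates back, `(σ x) i = x (σ i)`. Its image is thus supported on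
the domain of `σ`, and products correspond to `PEquiv.trans` in the same order. -/
theorem toCLM_mul (σ τ : I ≃. I) : toCLM σ * toCLM τ = toCLM (σ.trans τ) := by
  ext x i
  change (σ i).elim 0 (fun j => (τ j).elim 0 x) = ((σ i).bind τ).elim 0 x
  cases σ i <;> rfl

theorem toCLM_bot : toCLM (⊥ : I ≃. I) = 0 := by
  ext x i
  rfl

theorem star_toCLM (σ : I ≃. I) : star (toCLM σ) = toCLM σ.symm := by
  rw [ContinuousLinearMap.star_eq_adjoint]
  symm
  rw [ContinuousLinearMap.eq_adjoint_iff]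
  intro x y
  rw [lp.inner_eq_tsum, lp.inner_eq_tsum]
  have key : ∀ j : Function.support fun i => ⟪x i, toCLM σ y i⟫_ℂ, (σ j).isSome := by
    rintro ⟨j, hj⟩
    by_contra h
    have : σ j = none := by simpa using h
    simp [toCLM_apply, this] at hj
  have hget : ∀ j : Function.support fun i => ⟪x i, toCLM σ y i⟫_ℂ, σ.symm ((σ j).get (key j)) = some (j : I) := fun j =>
    σ.eq_some_iff.2 (Option.some_get _).symm
  -- Both inner products sum over the pairs `(j, σ j)`; the map `j ↦ σ j` matches their nonzero
  -- terms.
  refine tsum_eq_tsum_of_ne_zero_bij (fun j => (σ j).get (key j)) ?_ ?_ ?_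
  · intro j j' h
    have h1 := hget j
    rw [show (σ j).get (key j) = (σ j').get (key j') from h, hget j', Option.some_inj] at h1
    exact (Subtype.ext h1).symm
  · intro i hi
    have : (σ.symm i).isSome := by
      by_contra h
      have h' : σ.symm i = none := by simpa using h
      simp [toCLM_apply, h'] at hi
    obtain ⟨j, hj⟩ := Option.isSome_iff_exists.1 this
    have hj' : σ j = some i := σ.eq_some_iff.1 hj
    refine ⟨⟨j, ?_⟩, ?_⟩
    · simpa [toCLM_apply, hj, hj'] using hi
    · simp [hj']
  · intro j
    rw [toCLM_apply, toCLM_apply, hget j]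
    conv_rhs => rw [← Option.some_get (key j)]
    rfl

end PEquiv

namespace RowFiniteGraph

/-- Injections of `ℕ` indexed by the edges such that, for every vertex that receives an edge, the
ranges of the injections of the edges it receives form a partition of `ℕ`. -/
theorem exists_partition_embeddings {V : Type u} {Ed : Type v} (E : RowFiniteGraph V Ed) :
    ∃ k : Ed → (ℕ ↪ ℕ), (∀ e f n m, E.r e = E.r f → k e n = k f m → e = f) ∧
      ∀ e m, ∃ f n, E.r f = E.r e ∧ k f n = m := by
  have hθ : ∀ x, ∃ k : {e // E.r e = x} → (ℕ ↪ ℕ), (∀ e f n m, k e n = k f m → e = f) ∧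
      (Nonempty {e // E.r e = x} → ∀ m, ∃ f n, k f n = m) := fun x => by
    have : Finite {e // E.r e = x} := E.finite_fiber x
    rcases isEmpty_or_nonempty {e // E.r e = x} with h | h
    · exact ⟨fun _ => Function.Embedding.refl ℕ, fun e => h.elim e, fun ⟨e⟩ => h.elim e⟩
    · obtain ⟨θ⟩ := nonempty_equiv_of_countable (α := {e // E.r e = x} × ℕ) (β := ℕ)
      refine ⟨fun e => ⟨fun n => θ (e, n), fun n m hnm => ?_⟩, fun e f n m h => ?_, fun _ m => ?_⟩
      · exact congrArg Prod.snd (θ.injective hnm)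
      · exact congrArg Prod.fst (θ.injective h)
      · exact ⟨(θ.symm m).1, (θ.symm m).2, θ.apply_symm_apply m⟩
  choose k hk1 hk2 using hθ
  refine ⟨fun e => k (E.r e) ⟨e, rfl⟩, fun e f n m hr h => ?_, fun e m => ?_⟩
  · have aux : ∀ x (hx : E.r f = x), k (E.r f) ⟨f, rfl⟩ = k x ⟨f, hx⟩ := by
      rintro x rfl; rfl
    have h' : k (E.r e) ⟨e, rfl⟩ n = k (E.r e) ⟨f, hr.symm⟩ m := by
      rw [← aux _ hr.symm]; exact h
    exact congrArg Subtype.val (hk1 _ _ _ _ _ h')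
  · obtain ⟨⟨f, hf⟩, n, h⟩ := hk2 (E.r e) ⟨⟨e, rfl⟩⟩ m
    have aux : ∀ x (hx : E.r f = x), k (E.r f) ⟨f, rfl⟩ = k x ⟨f, hx⟩ := by
      rintro x rfl; rfl
    exact ⟨f, n, hf, (DFunLike.congr_fun (aux _ hf) n).trans h⟩

/-- The vertex projections of `C*(E)` do not vanish. -/
theorem p_ne_zero {V : Type u} {Ed : Type v} (E : RowFiniteGraph V Ed) (x : V) : E.p x ≠ 0 := by
  classical
  obtain ⟨k, hk1, hk2⟩ := E.exists_partition_embeddings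
  -- On `ℓ²(V × ℕ)` the projection of `x` is onto `{x} × ℕ`, and `S e` maps `{s e} × ℕ` bijectively
  -- onto the piece `{r e} × range (k e)`. The pieces of the edges into a vertex partition its copy
  -- of `ℕ`, which is the summation relation.
  let g : V → (ℕ ↪ V × ℕ) := fun x => ⟨fun n => (x, n), fun n m h => congrArg Prod.snd h⟩
  let f : Ed → (ℕ ↪ V × ℕ) := fun e =>
    ⟨fun n => (E.r e, k e n), fun n m h => (k e).injective (congrArg Prod.snd h)⟩
  have hg : ∀ x n, g x n = (x, n) := fun _ _ => rfl
  have hf : ∀ e n, f e n = (E.r e, k e n) := fun _ _ => rfl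
  have hCK : E.IsCKFamily (fun x => (PEquiv.ofEmbeddings (g x) (g x)).toCLM)
      (fun e => (PEquiv.ofEmbeddings (f e) (g (E.s e))).toCLM) :=
    { star_p := fun x => by rw [PEquiv.star_toCLM, PEquiv.ofEmbeddings_symm]
      p_mul_self := fun x => by rw [PEquiv.toCLM_mul, PEquiv.ofEmbeddings_trans]
      p_mul_p := fun x y hxy => by
        rw [PEquiv.toCLM_mul, PEquiv.ofEmbeddings_trans_eq_bot, PEquiv.toCLM_bot]
        exact fun n m h => hxy (congrArg Prod.fst h)
      star_s_mul_s := fun e => by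
        rw [PEquiv.star_toCLM, PEquiv.ofEmbeddings_symm, PEquiv.toCLM_mul,
          PEquiv.ofEmbeddings_trans]
      p_mul_s := fun e => by
        rw [PEquiv.toCLM_mul]
        congr 1
        ext1 ⟨y, m⟩
        change (PEquiv.ofEmbeddings _ _ _).bind (PEquiv.ofEmbeddings _ _) = _
        by_cases hy : y = E.r e
        · subst hy
          rw [← hg, PEquiv.ofEmbeddings_apply, Option.bind_some]
        · rw [PEquiv.ofEmbeddings_of_notMem (g (E.r e)) _ (i := (y, m))
              fun n h => hy (congrArg Prod.fst h).symm,
            PEquiv.ofEmbeddings_of_notMem (f e) _ (i := (y, m))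
              fun n h => hy (congrArg Prod.fst h).symm, Option.bind_none]
      sum_s := fun x ⟨e₀, he₀⟩ => by
        ext ξ ⟨y, m⟩
        simp only [PEquiv.star_toCLM, PEquiv.ofEmbeddings_symm, PEquiv.toCLM_mul,
          PEquiv.ofEmbeddings_trans, sum_apply, lp.coeFn_sum,
          Finset.sum_apply, PEquiv.toCLM_apply]
        by_cases hy : y = x
        · subst hy he₀
          obtain ⟨e, n, he, hn⟩ := hk2 e₀ m
          rw [Finset.sum_eq_single e]
          · rw [← hg, PEquiv.ofEmbeddings_apply, hg]
            rw [show (E.r e₀, m) = f e n by rw [hf, he, hn], PEquiv.ofEmbeddings_apply]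
          · intro e' he' hne
            rw [PEquiv.ofEmbeddings_of_notMem]
            · rfl
            · intro n' h
              have h2 : k e' n' = m := congrArg Prod.snd h
              have h1 : E.r e' = E.r e₀ := congrArg Prod.fst h
              exact hne (hk1 _ _ _ _ (h1.trans he.symm) (h2.trans hn.symm))
          · intro h; exact absurd (by simpa using he) h
        · rw [PEquiv.ofEmbeddings_of_notMem (g x) _ (i := (y, m))
              fun n h => hy (congrArg Prod.fst h).symm]
          refine Finset.sum_eq_zero fun e he => ?_
          have he' : E.r e = x := by simpa using he
          rw [PEquiv.ofEmbeddings_of_notMem (f e) _ (i := (y, m))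
              fun n h => hy ((congrArg Prod.fst h).symm.trans he')]
          rfl }
  obtain ⟨φ, hφ, -⟩ := exists_lift hCK
  intro h
  have h0 := hφ x
  rw [h, map_zero] at h0
  have h1 := congrArg (fun T => T (lp.single 2 (x, 0) (1 : ℂ)) (x, 0)) h0
  simp only [PEquiv.toCLM_apply] at h1
  rw [← hg x 0, PEquiv.ofEmbeddings_apply] at h1
  simp at h1

end RowFiniteGraph

end Nondegenerate

/-! ### The core and the gauge-invariant uniqueness theorem. -/

namespace RowFiniteGraph

/-- A path that has length `N`, or is shorter and starts at a vertex that receives no edge. -/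
def IsTerminal {V : Type u} {Ed : Type v} (E : RowFiniteGraph V Ed) (N : ℕ) (i : List Ed × V) :
    Prop :=
  E.IsPath i.1 i.2 ∧ (i.1.length = N ∨ i.1.length < N ∧ ∀ e, E.r e ≠ i.2)

theorem IsPath.append_singleton {V : Type u} {Ed : Type v} {E : RowFiniteGraph V Ed}
    {l : List Ed} {e : Ed} (h : E.IsPath l (E.r e)) : E.IsPath (l ++ [e]) (E.s e) := by
  induction l with
  | nil => exact ⟨rfl, trivial⟩
  | cons f l ih =>
    refine ⟨?_, ih h.2⟩
    rw [h.1]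
    cases l <;> rfl

/-- The span of `S_μ S_ν*` for `μ`, `ν` in a set of paths. -/
def matrixSpan {V : Type u} {Ed : Type v} {A : Type w} [NonUnitalCStarAlgebra A]
    (P : V → A) (S : Ed → A) (F : Set (List Ed × V)) : Submodule ℂ A :=
  Submodule.span ℂ (Set.image2
    (fun i j => pathElt P S i.1 i.2 * star (pathElt P S j.1 j.2)) F F)

theorem matrixSpan_mono {V : Type u} {Ed : Type v} {A : Type w} [NonUnitalCStarAlgebra A]
    (P : V → A) (S : Ed → A) {F G : Set (List Ed × V)} (h : F ⊆ G) :
    matrixSpan P S F ≤ matrixSpan P S G :=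
  Submodule.span_mono (Set.image2_subset h h)

theorem exists_finite_matrixSpan {V : Type u} {Ed : Type v} {A : Type w}
    [NonUnitalCStarAlgebra A] {P : V → A} {S : Ed → A} {F : Set (List Ed × V)} {a : A}
    (ha : a ∈ matrixSpan P S F) : ∃ G ⊆ F, G.Finite ∧ a ∈ matrixSpan P S G := by
  induction ha using Submodule.span_induction with
  | zero => exact ⟨∅, Set.empty_subset F, Set.finite_empty, zero_mem _⟩
  | add a b _ _ h1 h2 =>
    obtain ⟨G, hGF, hG, ha⟩ := h1
    obtain ⟨G', hGF', hG', hb⟩ := h2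
    exact ⟨G ∪ G', Set.union_subset hGF hGF', hG.union hG',
      add_mem (matrixSpan_mono P S Set.subset_union_left ha)
        (matrixSpan_mono P S Set.subset_union_right hb)⟩
  | smul c a _ h1 =>
    obtain ⟨G, hGF, hG, ha⟩ := h1
    exact ⟨G, hGF, hG, Submodule.smul_mem _ c ha⟩
  | mem a ha =>
    obtain ⟨i, hi, j, hj, rfl⟩ := ha
    refine ⟨{i, j}, Set.insert_subset hi (Set.singleton_subset_iff.2 hj),
      Set.toFinite _, Submodule.subset_span ⟨i, by simp, j, by simp, rfl⟩⟩

namespace IsCKFamily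

variable {V : Type u} {Ed : Type v} {E : RowFiniteGraph V Ed} {A : Type w}
  [NonUnitalCStarAlgebra A] {P : V → A} {S : Ed → A}

theorem star_pathElt_mul_pathElt_of_append (h : E.IsCKFamily P S) {N : ℕ} {l m : List Ed}
    {x y : V} (hi : E.IsTerminal N (l, x)) (hj : E.IsTerminal N (l ++ m, y))
    (hne : (l, x) ≠ (l ++ m, y)) : P x * pathElt P S m y = 0 := by
  refine h.p_mul_pathElt_of_ne m y ?_
  rintro rfl
  cases m with
  | nil => exact hne (by simp [pathRange])
  | cons e m =>
    have h1 : (l ++ e :: m).length ≤ N := by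
      rcases hj.2 with h | h
      · exact h.le
      · exact h.1.le
    rw [List.length_append, List.length_cons] at h1
    rcases hi.2 with h2 | h2
    · rw [show (l, E.pathRange (e :: m) y).1 = l from rfl] at h2
      omega
    · exact h2.2 e rfl

/-- Terminal paths give a system of matrix units. -/
theorem star_pathElt_mul_pathElt_of_ne (h : E.IsCKFamily P S) {N : ℕ} {i j : List Ed × V}
    (hi : E.IsTerminal N i) (hj : E.IsTerminal N j) (hij : i ≠ j) :
    star (pathElt P S i.1 i.2) * pathElt P S j.1 j.2 = 0 := by
  obtain ⟨l, x⟩ := i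
  obtain ⟨l', x'⟩ := j
  rcases h.star_pathElt_mul_pathElt l x l' x' with h0 | ⟨m, rfl, h0⟩ | ⟨m, rfl, h0⟩
  · exact h0
  · rw [← h.p_mul_star_pathElt, mul_assoc, h0,
      h.star_pathElt_mul_pathElt_of_append hi hj hij]
  · rw [← h.pathElt_mul_p l' x', ← mul_assoc, h0, ← h.star_p x', ← star_mul,
      h.star_pathElt_mul_pathElt_of_append hj hi hij.symm, star_zero]

/-- Inserting `P x = ∑ S_e S_e*` in the middle of `S_μ S_ν*` lengthens both paths by the same edge.
After `d` rounds the length is `N`, unless the process stops at a vertex that receives no edge. -/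
theorem monomial_mem_matrixSpan (h : E.IsCKFamily P S) (d : ℕ) {N : ℕ} {l l' : List Ed} {x : V}
    (hll' : l.length = l'.length) (hl : E.IsPath l x) (hl' : E.IsPath l' x)
    (hN : l.length + d = N) :
    pathElt P S l x * star (pathElt P S l' x) ∈ matrixSpan P S {i | E.IsTerminal N i} := by
  induction d generalizing l l' x with
  | zero =>
    exact Submodule.subset_span ⟨(l, x), ⟨hl, Or.inl (by simpa using hN)⟩, (l', x),
      ⟨hl', Or.inl (by simpa [← hll'] using hN)⟩, rfl⟩
  | succ d ih =>
    by_cases hx : ∃ e, E.r e = x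
    · have e1 : pathElt P S l x * star (pathElt P S l' x) =
          ∑ e ∈ (E.finite_fiber x).toFinset,
            pathElt P S (l ++ [e]) (E.s e) * star (pathElt P S (l' ++ [e]) (E.s e)) := by
        rw [← h.pathElt_mul_p, ← h.sum_s x hx, Finset.mul_sum, Finset.sum_mul]
        refine Finset.sum_congr rfl fun e he => ?_
        have he' : E.r e = x := by simpa using he
        subst he'
        rw [← h.pathElt_mul_s, ← h.pathElt_mul_s, star_mul]
        noncomm_ring
      rw [e1]
      refine sum_mem fun e he => ?_
      have he' : E.r e = x := by simpa using he
      subst he'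
      refine ih (by simpa using hll') hl.append_singleton hl'.append_singleton ?_
      rw [List.length_append, List.length_singleton, ← hN]
      ring
    · push Not at hx
      exact Submodule.subset_span ⟨(l, x), ⟨hl, Or.inr ⟨by dsimp only; omega, hx⟩⟩, (l', x),
        ⟨hl', Or.inr ⟨by dsimp only; omega, hx⟩⟩, rfl⟩

/-- Membership at every large level, not just at one, lets two elements be brought to a common level
and added. -/
theorem exists_mem_matrixSpan (h : E.IsCKFamily P S) {a : A} (ha : a ∈ coreSpan P S) :
    ∃ N₀, ∀ N ≥ N₀, a ∈ matrixSpan P S {i | E.IsTerminal N i} := by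
  induction ha using Submodule.span_induction with
  | zero => exact ⟨0, fun _ _ => zero_mem _⟩
  | add a b _ _ h1 h2 =>
    obtain ⟨N, hN⟩ := h1
    obtain ⟨M, hM⟩ := h2
    exact ⟨max N M, fun K hK => add_mem (hN K (le_of_max_le_left hK)) (hM K (le_of_max_le_right hK))⟩
  | smul c a _ h1 =>
    obtain ⟨N, hN⟩ := h1
    exact ⟨N, fun K hK => Submodule.smul_mem _ c (hN K hK)⟩
  | mem a ha =>
    obtain ⟨l, x, l', x', hll', rfl⟩ := ha
    by_cases hl : E.IsPath l x
    · by_cases hl' : E.IsPath l' x'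
      · by_cases hx : x = x'
        · subst hx
          exact ⟨l.length, fun N hN =>
            h.monomial_mem_matrixSpan (N - l.length) hll' hl hl' (by omega)⟩
        · refine ⟨0, fun _ _ => ?_⟩
          rw [← h.pathElt_mul_p, ← h.p_mul_star_pathElt, mul_assoc, ← mul_assoc (P x),
            h.p_mul_p _ _ hx, zero_mul, mul_zero]
          exact zero_mem _
      · exact ⟨0, fun _ _ => by
          rw [h.pathElt_of_not_isPath hl', star_zero, mul_zero]; exact zero_mem _⟩
    · exact ⟨0, fun _ _ => by
        rw [h.pathElt_of_not_isPath hl, zero_mul]; exact zero_mem _⟩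

theorem mul_mem_matrixSpan (h : E.IsCKFamily P S) {N : ℕ} {F : Set (List Ed × V)}
    (hF : ∀ i ∈ F, E.IsTerminal N i) {a b : A} (ha : a ∈ matrixSpan P S F)
    (hb : b ∈ matrixSpan P S F) : a * b ∈ matrixSpan P S F := by
  induction ha using Submodule.span_induction with
  | zero => simp
  | add a a' _ _ h1 h2 => rw [add_mul]; exact add_mem h1 h2
  | smul c a _ h1 => rw [smul_mul_assoc]; exact Submodule.smul_mem _ c h1
  | mem a ha =>
    obtain ⟨i, hi, j, hj, rfl⟩ := ha
    induction hb using Submodule.span_induction with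
    | zero => simp
    | add a a' _ _ h1 h2 => rw [mul_add]; exact add_mem h1 h2
    | smul c a _ h1 => rw [mul_smul_comm]; exact Submodule.smul_mem _ c h1
    | mem b hb =>
      obtain ⟨k, hk, m, hm, rfl⟩ := hb
      dsimp only
      rw [mul_assoc, ← mul_assoc (star _)]
      by_cases hjk : j = k
      · subst hjk
        rw [h.star_pathElt_mul_self (hF j hj).1]
        by_cases hij : i.2 = j.2
        · rw [← hij, ← mul_assoc, h.pathElt_mul_p]
          exact Submodule.subset_span ⟨i, hi, m, hm, rfl⟩
        · rw [← h.pathElt_mul_p i.1, mul_assoc, ← mul_assoc (P i.2), h.p_mul_p _ _ hij, zero_mul,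
            mul_zero]
          exact zero_mem _
      · rw [h.star_pathElt_mul_pathElt_of_ne (hF j hj) (hF k hk) hjk, zero_mul, mul_zero]
        exact zero_mem _

theorem star_mem_matrixSpan {F : Set (List Ed × V)} {a : A} (ha : a ∈ matrixSpan P S F) :
    star a ∈ matrixSpan P S F := by
  induction ha using Submodule.span_induction with
  | zero => simp
  | add a a' _ _ h1 h2 => rw [star_add]; exact add_mem h1 h2
  | smul c a _ h1 => rw [star_smul]; exact Submodule.smul_mem _ _ h1
  | mem a ha =>
    obtain ⟨i, hi, j, hj, rfl⟩ := ha
    dsimp only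
    rw [star_mul, star_star]
    exact Submodule.subset_span ⟨j, hj, i, hi, rfl⟩

/-- Matrix coefficients are multiples of vertex projections. -/
theorem exists_coeff (h : E.IsCKFamily P S) {N : ℕ} {F : Set (List Ed × V)}
    (hF : ∀ i ∈ F, E.IsTerminal N i) {a : A} (ha : a ∈ matrixSpan P S F) {i j : List Ed × V}
    (hi : i ∈ F) (hj : j ∈ F) :
    ∃ c : ℂ, star (pathElt P S i.1 i.2) * a * pathElt P S j.1 j.2 = c • P i.2 := by
  induction ha using Submodule.span_induction with
  | zero => exact ⟨0, by simp⟩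
  | add a b _ _ h1 h2 =>
    obtain ⟨c, hc⟩ := h1
    obtain ⟨d, hd⟩ := h2
    exact ⟨c + d, by rw [mul_add, add_mul, hc, hd, add_smul]⟩
  | smul d a _ h1 =>
    obtain ⟨c, hc⟩ := h1
    exact ⟨d * c, by rw [mul_smul_comm, smul_mul_assoc, hc, smul_smul]⟩
  | mem a ha =>
    obtain ⟨k, hk, m, hm, rfl⟩ := ha
    have e1 : star (pathElt P S i.1 i.2) * (pathElt P S k.1 k.2 * star (pathElt P S m.1 m.2)) *
        pathElt P S j.1 j.2 = (star (pathElt P S i.1 i.2) * pathElt P S k.1 k.2) *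
          (star (pathElt P S m.1 m.2) * pathElt P S j.1 j.2) := by noncomm_ring
    dsimp only
    rw [e1]
    by_cases hik : i = k
    · by_cases hmj : m = j
      · subst hik hmj
        rw [h.star_pathElt_mul_self (hF i hi).1, h.star_pathElt_mul_self (hF m hm).1]
        by_cases him : i.2 = m.2
        · exact ⟨1, by rw [← him, h.p_mul_self, one_smul]⟩
        · exact ⟨0, by rw [h.p_mul_p _ _ him, zero_smul]⟩
      · exact ⟨0, by rw [h.star_pathElt_mul_pathElt_of_ne (hF m hm) (hF j hj) hmj, mul_zero,
          zero_smul]⟩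
    · exact ⟨0, by rw [h.star_pathElt_mul_pathElt_of_ne (hF i hi) (hF k hk) hik, zero_mul,
          zero_smul]⟩

/-- The range projections of the paths in `F` add up to a left unit for the matrix algebra. -/
theorem sum_mul_mem_matrixSpan (h : E.IsCKFamily P S) {N : ℕ} {F : Finset (List Ed × V)}
    (hF : ∀ i ∈ F, E.IsTerminal N i) {a : A} (ha : a ∈ matrixSpan P S F) :
    ∑ i ∈ F, pathElt P S i.1 i.2 * star (pathElt P S i.1 i.2) * a = a := by
  induction ha using Submodule.span_induction with
  | zero => simp
  | add a b _ _ h1 h2 => simp only [mul_add, Finset.sum_add_distrib, h1, h2]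
  | smul d a _ h1 => simp only [mul_smul_comm, ← Finset.smul_sum, h1]
  | mem a ha =>
    obtain ⟨k, hk, m, hm, rfl⟩ := ha
    rw [Finset.sum_eq_single k]
    · rw [mul_assoc, ← mul_assoc (star _), h.star_pathElt_mul_self (hF k hk).1, ← mul_assoc,
        h.pathElt_mul_p]
    · intro i hi hik
      rw [mul_assoc, ← mul_assoc (star _), h.star_pathElt_mul_pathElt_of_ne (hF i hi) (hF k hk) hik,
        zero_mul, mul_zero]
    · exact fun h => absurd hk h

/-- An element of `matrixSpan` all of whose matrix coefficients vanish is zero. -/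
theorem eq_zero_of_coeff (h : E.IsCKFamily P S) {N : ℕ} {F : Finset (List Ed × V)}
    (hF : ∀ i ∈ F, E.IsTerminal N i) {a : A} (ha : a ∈ matrixSpan P S F)
    (h0 : ∀ i ∈ F, ∀ j ∈ F, star (pathElt P S i.1 i.2) * a * pathElt P S j.1 j.2 = 0) :
    a = 0 := by
  have h1 : ∀ i ∈ F, star (pathElt P S i.1 i.2) * a = 0 := by
    intro i hi
    rw [← star_eq_zero, star_mul, star_star,
      ← h.sum_mul_mem_matrixSpan hF (star_mem_matrixSpan ha), Finset.sum_mul]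
    refine Finset.sum_eq_zero fun j hj => ?_
    have e1 := congrArg star (h0 i hi j hj)
    rw [star_mul, star_mul, star_star, star_zero] at e1
    rw [mul_assoc, mul_assoc, e1, mul_zero]
  rw [← h.sum_mul_mem_matrixSpan hF ha]
  refine Finset.sum_eq_zero fun i hi => ?_
  rw [mul_assoc, h1 i hi, mul_zero]

/-- A homomorphism that does not annihilate any vertex projection is isometric on the core. -/
theorem norm_map_of_mem_coreSpan (h : E.IsCKFamily P S) {B : Type*} [NonUnitalCStarAlgebra B]
    (φ : A →⋆ₙₐ[ℂ] B) (hφ : ∀ x, φ (P x) ≠ 0) {a : A} (ha : a ∈ coreSpan P S) :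
    ‖φ a‖ = ‖a‖ := by
  obtain ⟨N, hN⟩ := h.exists_mem_matrixSpan ha
  obtain ⟨G, hG, hGfin, haG⟩ := exists_finite_matrixSpan (hN N le_rfl)
  lift G to Finset (List Ed × V) using hGfin
  have hF : ∀ i ∈ G, E.IsTerminal N i := hG
  -- A finite-dimensional `*`-algebra is closed, hence a `C*`-algebra, and injective homomorphisms
  -- of `C*`-algebras are isometric.
  let D : NonUnitalStarSubalgebra ℂ A :=
    { matrixSpan P S (G : Set (List Ed × V)) with
      mul_mem' := fun {x y} hx hy => h.mul_mem_matrixSpan hF hx hy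
      star_mem' := fun {x} hx => star_mem_matrixSpan hx }
  have : FiniteDimensional ℂ (matrixSpan P S (G : Set (List Ed × V))) :=
    FiniteDimensional.span_of_finite ℂ (G.finite_toSet.image2 _ G.finite_toSet)
  have hD : IsClosed (D : Set A) :=
    (matrixSpan P S (G : Set (List Ed × V))).closed_of_finiteDimensional
  let _ : NonUnitalCStarAlgebra D :=
    NonUnitalStarSubalgebra.nonUnitalCStarAlgebra D (h_closed := hD)
  let ψ : D →⋆ₙₐ[ℂ] B := φ.comp (NonUnitalStarSubalgebraClass.subtype D)
  -- A matrix coefficient of a kernel element is `c • P` with `c • φ (P) = 0`, and `φ (P) ≠ 0`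
  -- forces `c = 0`.
  have hψ : Function.Injective ψ := by
    rw [injective_iff_map_eq_zero]
    rintro ⟨b, hb⟩ h0
    have h0' : φ b = 0 := h0
    refine Subtype.ext (h.eq_zero_of_coeff hF hb fun i hi j hj => ?_)
    obtain ⟨c, hc⟩ := h.exists_coeff hF hb hi hj
    have h1 : c • φ (P i.2) = 0 := by
      rw [← map_smul, ← hc, map_mul, map_mul, h0', mul_zero, zero_mul]
    rcases smul_eq_zero.1 h1 with h2 | h2
    · rw [hc, h2, zero_smul]
    · exact absurd h2 (hφ _)
  exact NonUnitalStarAlgHom.norm_map ψ hψ ⟨a, haG⟩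

end IsCKFamily

/-- The gauge-invariant uniqueness theorem. -/
theorem injective_of_gauge_invariant {V : Type u} {Ed : Type v} (E : RowFiniteGraph V Ed)
    {B : Type*} [NonUnitalCStarAlgebra B] (φ : E.CStarAlg →⋆ₙₐ[ℂ] B) (hφ : ∀ x, φ (E.p x) ≠ 0)
    (hker : ∀ z a, φ a = 0 → φ (E.gauge z a) = 0) : Function.Injective φ := by
  rw [injective_iff_map_eq_zero]
  intro a ha
  apply E.eq_zero_of_expectation_star_mul_self
  have hcont : Continuous φ := AddMonoidHomClass.continuous_of_bound φ 1
    (by simpa using NonUnitalStarAlgHom.norm_apply_le φ)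
  have h0 : φ (E.expectation (star a * a)) = 0 :=
    E.expectation_mem (K := LinearMap.ker (φ : E.CStarAlg →ₗ[ℂ] B))
      (isClosed_singleton.preimage hcont)
      fun z => hker z _ (by rw [map_mul, ha, mul_zero])
  rw [← norm_le_zero_iff]
  refine le_of_forall_pos_le_add fun ε hε => ?_
  obtain ⟨x, hx, hxa⟩ := E.expectation_mem_closure (star a * a) (half_pos hε)
  set b := E.expectation (star a * a)
  -- `φ` is isometric at the core element `x` and kills `b`, so `‖x‖ = ‖φ (x - b)‖`.
  have h1 : ‖x‖ ≤ ‖b - x‖ := by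
    rw [← E.isCKFamily.norm_map_of_mem_coreSpan φ hφ hx, ← norm_neg, ← map_neg,
      show -x = (b - x) - b by abel, map_sub, h0, sub_zero]
    exact NonUnitalStarAlgHom.norm_apply_le φ _
  calc ‖b‖ = ‖(b - x) + x‖ := by rw [sub_add_cancel]
    _ ≤ ‖b - x‖ + ‖x‖ := norm_add_le _ _
    _ ≤ 0 + ε := by linarith

end RowFiniteGraph

/-! ### The quotient by a gauge-invariant ideal as a graph algebra. -/

/-- A `*`-homomorphism that vanishes on the kernel of a surjective one factors through it. -/
theorem NonUnitalStarAlgHom.exists_factor {A : Type u} {B : Type v} {C : Type w}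
    [NonUnitalCStarAlgebra A] [NonUnitalCStarAlgebra B] [NonUnitalCStarAlgebra C]
    (π : A →⋆ₙₐ[ℂ] B) (hπ : Function.Surjective π) (φ : A →⋆ₙₐ[ℂ] C)
    (h : ∀ a, π a = 0 → φ a = 0) : ∃ ψ : B →⋆ₙₐ[ℂ] C, ∀ a, ψ (π a) = φ a := by
  have key : ∀ a, φ (Function.surjInv hπ (π a)) = φ a := fun a => by
    rw [← sub_eq_zero, ← map_sub]
    exact h _ (by rw [map_sub, Function.surjInv_eq hπ, sub_self])
  refine ⟨{ toFun := fun b => φ (Function.surjInv hπ b)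
            map_smul' := fun c b => ?_
            map_zero' := ?_
            map_add' := fun a b => ?_
            map_mul' := fun a b => ?_
            map_star' := fun a => ?_ }, key⟩
  · obtain ⟨b, rfl⟩ := hπ b
    rw [← map_smul, key, key, map_smul]; rfl
  · rw [← map_zero π, key, map_zero]
  · obtain ⟨a, rfl⟩ := hπ a
    obtain ⟨b, rfl⟩ := hπ b
    rw [← map_add, key, key, key, map_add]
  · obtain ⟨a, rfl⟩ := hπ a
    obtain ⟨b, rfl⟩ := hπ b
    rw [← map_mul, key, key, key, map_mul]
  · obtain ⟨a, rfl⟩ := hπ a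
    rw [← map_star, key, key, map_star]

namespace RowFiniteGraph

theorem se_mem_of_source_mem {V : Type u} {Ed : Type v} (E : RowFiniteGraph V Ed)
    (J : ClosedIdeal E.CStarAlg) {e : Ed} (he : E.s e ∈ E.vertexSet J) :
    E.se e ∈ J.toSubmodule := by
  rw [← E.isCKFamily.s_mul_p e]
  exact J.mul_mem_left' _ he

/-- Modulo `J`, the generators outside `J` form a Cuntz–Krieger family of the quotient graph. -/
theorem isCKFamily_quotientGraph {V : Type u} {Ed : Type v} (E : RowFiniteGraph V Ed)
    (J : ClosedIdeal E.CStarAlg) {B : Type w} [NonUnitalCStarAlgebra B]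
    (π : E.CStarAlg →⋆ₙₐ[ℂ] B) (hπ : ∀ a ∈ J.toSubmodule, π a = 0) :
    (E.quotientGraph J).IsCKFamily (fun x => π (E.p x)) (fun e => π (E.se e)) := by
  have h := E.isCKFamily
  exact
    { star_p := fun x => by rw [← map_star, h.star_p]
      p_mul_self := fun x => by rw [← map_mul, h.p_mul_self]
      p_mul_p := fun x y hxy => by
        rw [← map_mul, h.p_mul_p _ _ fun h' => hxy (Subtype.ext h'), map_zero]
      star_s_mul_s := fun e => by rw [← map_star, ← map_mul, h.star_s_mul_s]; rfl
      p_mul_s := fun e => by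
        rw [← map_mul]
        exact congrArg π (h.p_mul_s e.1)
      sum_s := fun x ⟨e₀, he₀⟩ => by
        rw [← h.sum_s x.1 ⟨e₀.1, congrArg Subtype.val he₀⟩, map_sum]
        -- The edges missing from the quotient graph have their source in `H(J)`, so their partial
        -- isometries lie in `J` and their terms vanish under `π`.
        refine Finset.sum_bij_ne_zero (fun e _ _ => e.1) ?_ ?_ ?_ ?_
        · intro e he _
          have : (E.quotientGraph J).r e = x := by simpa using he
          have h' : E.r e.1 = x.1 := congrArg Subtype.val this
          simpa using h'
        · intro e _ _ f _ _ hef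
          exact Subtype.ext hef
        · intro e he hne
          have he' : E.r e = x.1 := by simpa using he
          have hs : E.s e ∉ E.vertexSet J := fun hs => hne (by
            rw [map_mul, hπ _ (E.se_mem_of_source_mem J hs), zero_mul])
          refine ⟨⟨e, hs⟩, ?_, ?_, rfl⟩
          · simpa using Subtype.ext he'
          · rwa [← map_star, ← map_mul]
        · intro e _ _
          rw [map_mul, map_star] }

/-- The quotient of `C*(E)` by a gauge-invariant ideal is the algebra of the quotient graph. -/
theorem nonempty_starAlgEquiv_of_gauge_invariant {V : Type u} {Ed : Type v}
    (E : RowFiniteGraph V Ed) (J : ClosedIdeal E.CStarAlg) (hJ : E.GaugeInvariant J)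
    {B : Type w} [NonUnitalCStarAlgebra B] (π : E.CStarAlg →⋆ₙₐ[ℂ] B)
    (hπ : Function.Surjective π) (hker : ∀ a, π a = 0 ↔ a ∈ J.toSubmodule) :
    Nonempty (B ≃⋆ₐ[ℂ] (E.quotientGraph J).CStarAlg) := by
  obtain ⟨φ, hφp, hφs⟩ := exists_lift (E.isCKFamily_quotientGraph J π fun a => (hker a).2)
  have hinj : Function.Injective φ := by
    refine injective_of_gauge_invariant _ φ (fun x h => ?_) fun z a ha => ?_
    · rw [hφp] at h
      exact x.2 ((hker _).1 h)
    · obtain ⟨ψ, hψ⟩ := NonUnitalStarAlgHom.exists_factor π hπ (π.comp (E.gauge z))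
        fun a ha => (hker _).2 (hJ z a ((hker a).1 ha))
      have hcomm : φ.comp ((E.quotientGraph J).gauge z) = ψ.comp φ := by
        refine hom_ext (fun x => ?_) fun e => ?_
        · simp only [NonUnitalStarAlgHom.comp_apply, gauge_p, hφp, hψ]
        · simp only [NonUnitalStarAlgHom.comp_apply, gauge_se, map_smul, hφs, hψ]
      have := DFunLike.congr_fun hcomm a
      simp only [NonUnitalStarAlgHom.comp_apply, ha, map_zero] at this
      exact this
  have hcont : Continuous π := AddMonoidHomClass.continuous_of_bound π 1
    (by simpa using NonUnitalStarAlgHom.norm_apply_le π)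
  -- Being injective, `φ` is isometric and has closed range; surjectivity then needs checking only
  -- on the images of the monomials.
  have hclosed : IsClosed (Set.range φ) :=
    (NonUnitalStarAlgHom.isometry φ hinj).isClosedEmbedding.isClosed_range
  have hpath : ∀ l x, π (pathElt E.p E.se l x) ∈ NonUnitalStarAlgHom.range φ := by
    intro l x
    induction l with
    | nil =>
      by_cases hx : x ∈ E.vertexSet J
      · rw [pathElt, (hker _).2 hx]; exact zero_mem _
      · exact ⟨_, hφp ⟨x, hx⟩⟩
    | cons e l ih =>
      rw [pathElt, map_mul]
      refine mul_mem ?_ ih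
      by_cases hx : E.s e ∈ E.vertexSet J
      · rw [(hker _).2 (E.se_mem_of_source_mem J hx)]; exact zero_mem _
      · exact ⟨_, hφs ⟨e, hx⟩⟩
  have hsurj : Function.Surjective φ := by
    intro b
    obtain ⟨a, rfl⟩ := hπ b
    refine (hclosed.preimage hcont).closure_subset_iff.2 (fun c hc => ?_)
      (E.dense_span_monomials a)
    change π c ∈ NonUnitalStarAlgHom.range φ
    induction hc using Submodule.span_induction with
    | zero => rw [map_zero]; exact zero_mem _
    | add a b _ _ h1 h2 => rw [map_add]; exact add_mem h1 h2
    | smul c a _ h1 => rw [map_smul]; exact SMulMemClass.smul_mem c h1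
    | mem a ha =>
      obtain ⟨l, x, l', x', rfl⟩ := ha
      rw [map_mul, map_star]
      exact mul_mem (hpath _ _) (star_mem (hpath _ _))
  exact ⟨(StarAlgEquiv.ofBijective φ ⟨hinj, hsurj⟩).symm⟩

end RowFiniteGraph

/-! ### Compression along an infinite path. -/

namespace RowFiniteGraph

/-- The product of the `j` edges of an infinite path from position `i` on. -/
def segmentElt {V : Type u} {Ed : Type v} {A : Type w} [Mul A] (E : RowFiniteGraph V Ed)
    (P : V → A) (S : Ed → A) (β : ℕ → Ed) (i j : ℕ) : A :=
  pathElt P S ((List.range' i j).map β) (E.r (β (i + j)))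

namespace IsCKFamily

variable {V : Type u} {Ed : Type v} {E : RowFiniteGraph V Ed} {A : Type w}
  [NonUnitalCStarAlgebra A] {P : V → A} {S : Ed → A} {β : ℕ → Ed}

theorem segmentElt_mul_s (h : E.IsCKFamily P S) (hβ : ∀ i, E.s (β i) = E.r (β (i + 1)))
    (i j : ℕ) : E.segmentElt P S β i j * S (β (i + j)) = E.segmentElt P S β i (j + 1) := by
  rw [segmentElt, segmentElt, h.pathElt_mul_s, hβ, List.range'_1_concat, List.map_append, add_assoc]
  rfl

theorem star_segmentElt_mul_self (h : E.IsCKFamily P S)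
    (hβ : ∀ i, E.s (β i) = E.r (β (i + 1))) (i j : ℕ) :
    star (E.segmentElt P S β i j) * E.segmentElt P S β i j = P (E.r (β (i + j))) := by
  induction j with
  | zero => exact h.star_pathElt_mul_self trivial
  | succ j ih =>
    rw [← h.segmentElt_mul_s hβ, star_mul, mul_assoc, ← mul_assoc (star (E.segmentElt _ _ _ _ _)),
      ih, h.p_mul_s, h.star_s_mul_s, hβ, add_assoc]

/-- A path no longer than the segment is either an initial piece, which cancels, or orthogonal to
it. When the edge lists coincide the end vertices may still differ, and then the product is zero. -/
theorem star_pathElt_mul_segmentElt (h : E.IsCKFamily P S) (l : List Ed) (x : V) (i j : ℕ)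
    (hl : l.length ≤ j) : star (pathElt P S l x) * E.segmentElt P S β i j = 0 ∨
      star (pathElt P S l x) * E.segmentElt P S β i j =
        E.segmentElt P S β (i + l.length) (j - l.length) := by
  rcases h.star_pathElt_mul_pathElt l x ((List.range' i j).map β) (E.r (β (i + j))) with
    h0 | ⟨m, hm, h0⟩ | ⟨m, hm, h0⟩
  · exact Or.inl h0
  · right
    have h1 : m = (List.range' (i + l.length) (j - l.length)).map β := by
      have := congrArg (List.drop l.length) hm
      rw [List.drop_left, ← List.map_drop, List.drop_range', mul_one] at this
      exact this.symm
    rw [segmentElt, h0, segmentElt, h1]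
    congr 3
    omega
  · have hlen := congrArg List.length hm
    simp only [List.length_append, List.length_map, List.length_range'] at hlen
    have hm0 : m = [] := List.length_eq_zero_iff.1 (by omega)
    subst hm0
    rw [segmentElt, h0]
    have hj : j - l.length = 0 := by simp only [List.length_nil] at hlen; omega
    have hij : i + l.length + 0 = i + j := by simp only [List.length_nil] at hlen; omega
    by_cases hx : x = E.r (β (i + j))
    · right
      rw [hj, segmentElt, hij, hx, List.range'_zero, List.map_nil, pathElt, h.star_p]
    · left
      have e1 := congrArg (· * P (E.r (β (i + j)))) h0
      rw [mul_assoc, h.pathElt_mul_p, h0, pathElt, h.star_p, h.p_mul_p _ _ hx] at e1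
      rw [pathElt, h.star_p, e1]

/-- Compressing an element of the core to a sufficiently long initial segment of an infinite path
gives a multiple of a vertex projection. -/
theorem exists_compression (h : E.IsCKFamily P S) (hβ : ∀ i, E.s (β i) = E.r (β (i + 1)))
    {a : A} (ha : a ∈ coreSpan P S) :
    ∃ k₀, ∀ k ≥ k₀, ∃ c : ℂ,
      star (E.segmentElt P S β 0 k) * a * E.segmentElt P S β 0 k = c • P (E.r (β k)) := by
  induction ha using Submodule.span_induction with
  | zero => exact ⟨0, fun _ _ => ⟨0, by simp⟩⟩
  | add a b _ _ h1 h2 =>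
    obtain ⟨N, hN⟩ := h1
    obtain ⟨M, hM⟩ := h2
    refine ⟨max N M, fun k hk => ?_⟩
    obtain ⟨c, hc⟩ := hN k (le_of_max_le_left hk)
    obtain ⟨d, hd⟩ := hM k (le_of_max_le_right hk)
    exact ⟨c + d, by rw [mul_add, add_mul, hc, hd, add_smul]⟩
  | smul d a _ h1 =>
    obtain ⟨N, hN⟩ := h1
    refine ⟨N, fun k hk => ?_⟩
    obtain ⟨c, hc⟩ := hN k hk
    exact ⟨d * c, by rw [mul_smul_comm, smul_mul_assoc, hc, smul_smul]⟩
  | mem a ha =>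
    obtain ⟨l, x, l', x', hll', rfl⟩ := ha
    -- Once `k` is at least the common length of both paths, each factor is zero or the same tail of
    -- the segment, because equal lengths are cancelled; a tail times its adjoint on the left is a
    -- vertex projection.
    refine ⟨l.length, fun k hk => ?_⟩
    have e1 : star (E.segmentElt P S β 0 k) * (pathElt P S l x * star (pathElt P S l' x')) *
        E.segmentElt P S β 0 k = star (star (pathElt P S l x) * E.segmentElt P S β 0 k) *
          (star (pathElt P S l' x') * E.segmentElt P S β 0 k) := by
      rw [star_mul, star_star]
      noncomm_ring
    rw [e1]
    rcases h.star_pathElt_mul_segmentElt l x 0 k hk with h1 | h1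
    · exact ⟨0, by rw [h1, star_zero, zero_mul, zero_smul]⟩
    rcases h.star_pathElt_mul_segmentElt l' x' 0 k (hll' ▸ hk) with h2 | h2
    · exact ⟨0, by rw [h2, mul_zero, zero_smul]⟩
    refine ⟨1, ?_⟩
    rw [h1, h2, ← hll', h.star_segmentElt_mul_self hβ, one_smul]
    congr 3
    omega

theorem norm_p_le_one (h : E.IsCKFamily P S) (x : V) : ‖P x‖ ≤ 1 := by
  have h1 : ‖P x‖ * ‖P x‖ = ‖P x‖ := by
    rw [← CStarRing.norm_star_mul_self, h.star_p, h.p_mul_self]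
  nlinarith [norm_nonneg (P x)]

theorem norm_segmentElt_le_one (h : E.IsCKFamily P S) (hβ : ∀ i, E.s (β i) = E.r (β (i + 1)))
    (i j : ℕ) : ‖E.segmentElt P S β i j‖ ≤ 1 := by
  have h1 : ‖E.segmentElt P S β i j‖ * ‖E.segmentElt P S β i j‖ ≤ 1 := by
    rw [← CStarRing.norm_star_mul_self, h.star_segmentElt_mul_self hβ]
    exact h.norm_p_le_one _
  nlinarith [norm_nonneg (E.segmentElt P S β i j)]

theorem norm_s (h : E.IsCKFamily P S) {e : Ed} (he : P (E.s e) ≠ 0) : ‖S e‖ = 1 := by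
  have h1 : ‖P (E.s e)‖ * ‖P (E.s e)‖ = ‖P (E.s e)‖ := by
    rw [← CStarRing.norm_star_mul_self, h.star_p, h.p_mul_self]
  have h2 : ‖P (E.s e)‖ = 1 := mul_right_cancel₀ (norm_ne_zero_iff.2 he) (by rw [h1, one_mul])
  have h3 : ‖S e‖ * ‖S e‖ = 1 := by rw [← CStarRing.norm_star_mul_self, h.star_s_mul_s, h2]
  nlinarith [norm_nonneg (S e)]

/-- If `a` annihilates all edges that leave an infinite path, then `a` lives on the
initial segments of the path. -/
theorem mul_segmentElt (h : E.IsCKFamily P S) (hβ : ∀ i, E.s (β i) = E.r (β (i + 1))) {a : A}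
    (ha : ∀ k e, e ≠ β k → E.r e = E.r (β k) → a * E.segmentElt P S β 0 k * S e = 0) (k : ℕ) :
    a * E.segmentElt P S β 0 k * star (E.segmentElt P S β 0 k) = a * P (E.r (β 0)) := by
  induction k with
  | zero =>
    change a * P _ * star (P _) = _
    rw [h.star_p, mul_assoc, h.p_mul_self]
  | succ k ih =>
    rw [← ih]
    have e1 : a * E.segmentElt P S β 0 k =
        a * (E.segmentElt P S β 0 k * P (E.r (β k))) := by
      rw [segmentElt, zero_add, h.pathElt_mul_p]
    -- Expanding the projection at the end of the segment over its incoming edges, `a` kills every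
    -- term but that of `β k`, which lengthens the segment by one edge.
    conv_rhs => rw [e1, ← h.sum_s (E.r (β k)) ⟨β k, rfl⟩]
    rw [Finset.mul_sum, Finset.mul_sum, Finset.sum_mul, Finset.sum_eq_single (β k)]
    · rw [← h.segmentElt_mul_s hβ, zero_add, star_mul]
      simp only [mul_assoc]
    · intro e he hne
      have he' : E.r e = E.r (β k) := by simpa using he
      rw [← mul_assoc, ← mul_assoc, ha k e hne he', zero_mul, zero_mul]
    · intro hk
      exact absurd (by simp) hk

end IsCKFamily

end RowFiniteGraph

/-! ### Annihilators and Condition (L) for the quotient graph. -/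

/-- The annihilator of a closed ideal, as a closed submodule. -/
def ClosedIdeal.annihilator {A : Type u} [NonUnitalCStarAlgebra A] (J : ClosedIdeal A) :
    Submodule ℂ A where
  carrier := annihilatorSet J.carrier
  add_mem' {a b} ha hb x hx := by
    rw [add_mul, mul_add, (ha x hx).1, (ha x hx).2, (hb x hx).1, (hb x hx).2]; simp
  zero_mem' x _ := by simp
  smul_mem' c a ha x hx := by
    rw [smul_mul_assoc, mul_smul_comm, (ha x hx).1, (ha x hx).2]; simp

theorem ClosedIdeal.isClosed_annihilator {A : Type u} [NonUnitalCStarAlgebra A]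
    (J : ClosedIdeal A) : IsClosed (J.annihilator : Set A) := by
  have : (J.annihilator : Set A) = ⋂ x ∈ J.carrier, {a | a * x = 0 ∧ x * a = 0} := by
    ext a
    simp only [Set.mem_iInter]
    rfl
  rw [this]
  refine isClosed_biInter fun x _ => ?_
  exact (isClosed_eq (by fun_prop) continuous_const).inter
    (isClosed_eq (by fun_prop) continuous_const)

theorem ClosedIdeal.star_mem_annihilator {A : Type u} [NonUnitalCStarAlgebra A]
    (J : ClosedIdeal A) {a : A} (ha : a ∈ J.annihilator) : star a ∈ J.annihilator := by
  intro x hx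
  have h := ha _ (J.star_mem hx)
  constructor
  · rw [← star_star x, ← star_mul, h.2, star_zero]
  · rw [← star_star x, ← star_mul, h.1, star_zero]

theorem ClosedIdeal.mul_mem_annihilator {A : Type u} [NonUnitalCStarAlgebra A]
    (J : ClosedIdeal A) {a : A} (b c : A) (ha : a ∈ J.annihilator) :
    b * a * c ∈ J.annihilator := by
  intro x hx
  constructor
  · rw [mul_assoc, mul_assoc, (ha _ (J.mul_mem_left' c hx)).1, mul_zero]
  · rw [← mul_assoc, ← mul_assoc, (ha _ (J.mul_mem_right' b hx)).2, zero_mul]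

/-- The set of all `a` with `p a p = a`. -/
def corner {A : Type u} [NonUnitalCStarAlgebra A] (p : A) : Submodule ℂ A where
  carrier := {x | p * x * p = x}
  add_mem' {x y} hx hy := by
    change _ * (x + y) * _ = x + y
    rw [mul_add, add_mul, hx, hy]
  zero_mem' := by simp
  smul_mem' c x hx := by
    change _ * (c • x) * _ = c • x
    rw [mul_smul_comm, smul_mul_assoc, hx]

theorem isClosed_corner {A : Type u} [NonUnitalCStarAlgebra A] (p : A) :
    IsClosed (corner p : Set A) :=
  isClosed_eq (f := fun x => p * x * p) (by fun_prop) continuous_id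

namespace RowFiniteGraph

/-- Every `x ∈ J` is `γ_z` of `γ_{z⁻¹} x`, which again lies in `J`; so `γ_z` preserves the vanishing
of the products. -/
theorem gauge_mem_annihilator {V : Type u} {Ed : Type v} (E : RowFiniteGraph V Ed)
    {J : ClosedIdeal E.CStarAlg} (hJ : E.GaugeInvariant J) (z : Circle) {a : E.CStarAlg}
    (ha : a ∈ J.annihilator) : E.gauge z a ∈ J.annihilator := by
  intro x hx
  have h := ha _ (hJ z⁻¹ x hx)
  constructor
  · rw [← E.gauge_gauge_inv z x, ← map_mul, h.1, map_zero]
  · rw [← E.gauge_gauge_inv z x, ← map_mul, h.2, map_zero]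

/-- An element of the annihilator of `J` in the corner of the first vertex of an infinite path
vanishes if it is a value of the expectation, all edges that leave the path have their sources in
`H(J)`, and such edges exist arbitrarily far along the path. -/
theorem eq_zero_of_mem_annihilator {V : Type u} {Ed : Type v} (E : RowFiniteGraph V Ed)
    (J : ClosedIdeal E.CStarAlg) {β : ℕ → Ed} (hβ : ∀ i, E.s (β i) = E.r (β (i + 1)))
    (hexit : ∀ k e, e ≠ β k → E.r e = E.r (β k) → E.s e ∈ E.vertexSet J)
    (hentry : ∀ k₀, ∃ k ≥ k₀, ∃ e, e ≠ β k ∧ E.r e = E.r (β k))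
    {b : E.CStarAlg} (hb : b ∈ J.annihilator)
    (hcorner : E.p (E.r (β 0)) * b * E.p (E.r (β 0)) = b)
    (happrox : ∀ ε > 0, ∃ x ∈ coreSpan E.p E.se, ‖b - x‖ < ε) : b = 0 := by
  have h := E.isCKFamily
  have hw : E.p (E.r (β 0)) * E.p (E.r (β 0)) = E.p (E.r (β 0)) := h.p_mul_self _
  have hright : b * E.p (E.r (β 0)) = b := by
    rw [← hcorner, mul_assoc, hw]
  have hleft : star b * E.p (E.r (β 0)) = star b := by
    rw [← h.star_p, ← star_mul]
    congr 1
    rw [← hcorner]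
    simp only [← mul_assoc, hw]
  have hkill : ∀ {a : E.CStarAlg}, a ∈ J.annihilator → ∀ k e, e ≠ β k → E.r e = E.r (β k) →
      a * E.segmentElt E.p E.se β 0 k * E.se e = 0 := fun {a} ha k e he hr => by
    rw [mul_assoc]
    exact (ha _ (J.mul_mem_left' _ (E.se_mem_of_source_mem J (hexit k e he hr)))).1
  rw [← norm_le_zero_iff]
  refine le_of_forall_pos_le_add fun ε hε => ?_
  obtain ⟨x, hx, hbx⟩ := happrox (ε / 2) (half_pos hε)
  obtain ⟨k₀, hk₀⟩ := h.exists_compression hβ hx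
  obtain ⟨k, hk, e, hne, hr⟩ := hentry k₀
  obtain ⟨c, hc⟩ := hk₀ k hk
  set t := E.segmentElt E.p E.se β 0 k with ht
  have htn : ‖t‖ ≤ 1 := h.norm_segmentElt_le_one hβ 0 k
  -- `b` and `star b` lie in `J^⊥` and kill the side branches, so `t t*` acts as a unit for `b` on
  -- both sides.
  have hbt : b * t * star t = b := (h.mul_segmentElt hβ (hkill hb) k).trans hright
  have hbt' : t * star t * b = b := by
    have := (h.mul_segmentElt hβ (hkill (J.star_mem_annihilator hb)) k).trans hleft
    have := congrArg star this
    simpa only [star_mul, star_star, mul_assoc] using this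
  have hdiff : ‖star t * b * t - c • E.p (E.r (β k))‖ ≤ ε / 2 := by
    rw [← hc, ← sub_mul, ← mul_sub]
    calc ‖star t * (b - x) * t‖ ≤ ‖star t‖ * ‖b - x‖ * ‖t‖ := norm_mul₃_le
      _ ≤ 1 * (ε / 2) * 1 := by
        rw [norm_star]
        gcongr
      _ = ε / 2 := by ring
  have hse : ‖E.se e‖ = 1 := h.norm_s (E.p_ne_zero _)
  have hcn : ‖c‖ ≤ ε / 2 := by
    -- The side branch `e` at position `k` lies in `J`, so `b t s_e = 0`. Only `-c s_e` remains,
    -- with `‖s_e‖ = 1` because its source projection is nonzero.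
    have e1 : (star t * b * t - c • E.p (E.r (β k))) * E.se e = -(c • E.se e) := by
      rw [sub_mul, smul_mul_assoc, ← hr, h.p_mul_s, mul_assoc, mul_assoc, ← mul_assoc b,
        hkill hb k e hne hr, mul_zero, zero_sub]
    have e2 := norm_mul_le (star t * b * t - c • E.p (E.r (β k))) (E.se e)
    rw [e1, norm_neg, norm_smul, hse, mul_one, mul_one] at e2
    exact e2.trans hdiff
  have hcomp : ‖star t * b * t‖ ≤ ε := by
    calc ‖star t * b * t‖ = ‖(star t * b * t - c • E.p (E.r (β k))) + c • E.p (E.r (β k))‖ := by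
          rw [sub_add_cancel]
      _ ≤ ε / 2 + ‖c‖ * ‖E.p (E.r (β k))‖ := by
          refine (norm_add_le _ _).trans (add_le_add hdiff (norm_smul_le _ _))
      _ ≤ ε / 2 + (ε / 2) * 1 := by
          gcongr
          exact h.norm_p_le_one _
      _ = ε := by ring
  have e3 : b = t * (star t * b * t) * star t := by
    rw [mul_assoc, mul_assoc (star t * b), mul_assoc (star t), ← mul_assoc b, hbt, ← mul_assoc,
      hbt']
  calc ‖b‖ = ‖t * (star t * b * t) * star t‖ := congrArg norm e3
    _ ≤ ‖t‖ * ‖star t * b * t‖ * ‖star t‖ := norm_mul₃_le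
    _ ≤ 1 * ε * 1 := by rw [norm_star]; gcongr
    _ = 0 + ε := by ring

/-- The first vertex of an infinite path as in `eq_zero_of_mem_annihilator` lies in `H(J)` if `J`
is regular. -/
theorem mem_vertexSet_of_path {V : Type u} {Ed : Type v} (E : RowFiniteGraph V Ed)
    (J : ClosedIdeal E.CStarAlg) (hreg : J.IsRegular) (hJ : E.GaugeInvariant J) {β : ℕ → Ed}
    (hβ : ∀ i, E.s (β i) = E.r (β (i + 1)))
    (hexit : ∀ k e, e ≠ β k → E.r e = E.r (β k) → E.s e ∈ E.vertexSet J)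
    (hentry : ∀ k₀, ∃ k ≥ k₀, ∃ e, e ≠ β k ∧ E.r e = E.r (β k)) :
    E.r (β 0) ∈ E.vertexSet J := by
  have h := E.isCKFamily
  set w := E.r (β 0) with hw
  -- The expectation of `(a p_w)* (a p_w)` stays in `J^⊥` and in the corner of `p_w`, and it is
  -- approximated by core elements; so it vanishes, and faithfulness gives `a p_w = 0`.
  have key : ∀ a ∈ J.annihilator, a * E.p w = 0 := by
    intro a ha
    apply E.eq_zero_of_expectation_star_mul_self
    have hb : star (a * E.p w) * (a * E.p w) ∈ J.annihilator := by
      have := J.mul_mem_annihilator (star (a * E.p w)) (E.p w) ha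
      rwa [mul_assoc] at this
    have hgp : ∀ z, E.p w * E.gauge z (star (a * E.p w) * (a * E.p w)) * E.p w =
        E.gauge z (star (a * E.p w) * (a * E.p w)) := fun z => by
      have hp := h.p_mul_self w
      have hp' : ∀ y, E.p w * (E.p w * y) = E.p w * y := fun y => by rw [← mul_assoc, hp]
      have hb' : E.p w * (star (a * E.p w) * (a * E.p w)) * E.p w =
          star (a * E.p w) * (a * E.p w) := by
        simp only [star_mul, h.star_p, mul_assoc, hp, hp']
      have e1 := congrArg (E.gauge z) hb'
      rwa [map_mul, map_mul, gauge_p] at e1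
    refine E.eq_zero_of_mem_annihilator J hβ hexit hentry
      (E.expectation_mem J.isClosed_annihilator fun z => E.gauge_mem_annihilator hJ z hb) ?_
      fun ε hε => E.expectation_mem_closure _ hε
    exact E.expectation_mem (isClosed_corner (E.p w)) hgp
  change E.p w ∈ J.carrier
  rw [hreg]
  intro a ha
  refine ⟨?_, key a ha⟩
  have := congrArg star (key (star a) (J.star_mem_annihilator ha))
  rwa [star_mul, star_star, star_zero, h.star_p] at this

/-- A cycle of `E/J` without entry, repeated periodically, is an infinite path whose side branches
all come from `H(J)`. One entry in `E` recurs in every period, so the first vertex would lie in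
`H(J)`. -/
theorem conditionL_quotientGraph {V : Type u} {Ed : Type v} (E : RowFiniteGraph V Ed)
    (hL : E.ConditionL) (J : ClosedIdeal E.CStarAlg) (hreg : J.IsRegular)
    (hJ : E.GaugeInvariant J) : (E.quotientGraph J).ConditionL := by
  intro n α hα
  by_contra! hno
  let β : ℕ → Ed := fun k => (α (Fin.ofNat (n + 1) k)).1
  have hβ : ∀ i, E.s (β i) = E.r (β (i + 1)) := by
    intro i
    have hlt : i % (n + 1) < n + 1 := Nat.mod_lt _ n.succ_pos
    rcases Nat.lt_succ_iff_lt_or_eq.1 hlt with hi | hi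
    · have h1 := congrArg Subtype.val (hα.1 ⟨i % (n + 1), hi⟩)
      have e1 : Fin.ofNat (n + 1) i = Fin.castSucc ⟨i % (n + 1), hi⟩ := Fin.ext rfl
      have e2 : Fin.ofNat (n + 1) (i + 1) = Fin.succ ⟨i % (n + 1), hi⟩ := by
        refine Fin.ext ?_
        change (i + 1) % (n + 1) = i % (n + 1) + 1
        rw [Nat.add_mod, Nat.mod_eq_of_lt (a := 1) (by omega), Nat.mod_eq_of_lt (by omega)]
      simp only [β, e1, e2]
      exact h1
    · have h1 := congrArg Subtype.val hα.2
      have e1 : Fin.ofNat (n + 1) i = Fin.last n := Fin.ext hi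
      have e2 : Fin.ofNat (n + 1) (i + 1) = 0 := by
        refine Fin.ext ?_
        change (i + 1) % (n + 1) = 0
        rw [Nat.add_mod, hi, Nat.add_mod_mod, Nat.mod_self]
      simp only [β, e1, e2]
      exact h1.symm
  have hexit : ∀ k e, e ≠ β k → E.r e = E.r (β k) → E.s e ∈ E.vertexSet J := by
    intro k e hne hr
    by_contra hs
    exact hno (Fin.ofNat (n + 1) k) ⟨e, hs⟩ (fun h' => hne (congrArg Subtype.val h'))
      (Subtype.ext hr)
  have hcyc : E.IsCycle n fun i => (α i).1 :=
    ⟨fun i => congrArg Subtype.val (hα.1 i), congrArg Subtype.val hα.2⟩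
  obtain ⟨i, e, hne, hr⟩ := hL n _ hcyc
  have hentry : ∀ k₀, ∃ k ≥ k₀, ∃ e, e ≠ β k ∧ E.r e = E.r (β k) := by
    intro k₀
    -- The entry at position `i` of the cycle recurs `k₀` periods later, at an index at least `k₀`.
    refine ⟨i + (n + 1) * k₀, by nlinarith [Nat.zero_le (n * k₀), i.1.zero_le], e, ?_⟩
    have e1 : Fin.ofNat (n + 1) (i + (n + 1) * k₀) = i := by
      refine Fin.ext ?_
      change (i + (n + 1) * k₀) % (n + 1) = i
      rw [Nat.add_mul_mod_self_left, Nat.mod_eq_of_lt i.2]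
    simp only [β, e1]
    exact ⟨hne, hr⟩
  exact ((E.quotientGraph J).r (α (Fin.ofNat (n + 1) 0))).2
    (E.mem_vertexSet_of_path J hreg hJ hβ hexit hentry)

end RowFiniteGraph

/-! ### The theorem. -/

theorem mainTheorem1 {V : Type*} {Ed : Type*} (E : RowFiniteGraph V Ed) (hL : E.ConditionL)
    (J : ClosedIdeal E.CStarAlg) (hreg : J.IsRegular) (hgauge : E.GaugeInvariant J) :
    (E.quotientGraph J).ConditionL ∧
      Nonempty (J.Quotient ≃⋆ₐ[ℂ] (E.quotientGraph J).CStarAlg) := by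
  refine ⟨E.conditionL_quotientGraph hL J hreg hgauge, ?_⟩
  -- The `C*`-structure serves only to apply the preceding theory: the isomorphism involves only the
  -- algebraic operations, which agree with those declared on `J.Quotient`.
  let _ := J.quotientCStarAlgebra
  have hker : ∀ a, J.quotientHom a = 0 ↔ a ∈ J.toSubmodule := fun a => by
    have h := J.toQuot_eq (a := a) (b := 0)
    rwa [sub_zero, J.toQuot.map_zero] at h
  obtain ⟨Φ⟩ := E.nonempty_starAlgEquiv_of_gauge_invariant J hgauge J.quotientHom
    J.toQuot_surjective hker
  exact ⟨Φ⟩
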